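/- Let $d\ge 1$, $1<p,q<\infty$, $\tau\in(0,1]$, let $\mathbb K=\mathbb R$ or $\mathbb C$, and write $p'=p/(p-1)$, $q'=q/(q-1)$, $a_+=\max\{a,0\}$. Let $\mathcal R_d$ be the set of dyadic rectangles $I=I_1\times\dots\times I_d\subset[0,1]^d$ with $I_i=2^{-j_i}(k_i+[0,1))$, $j_i,k_i\in\mathbb N_0$, $0\le k_i<2^{j_i}$. Let $\mathfrak f_{p,q}(\mathcal R_d)$ be the space of all sequences $x=(x_I)_{I\in\mathcal R_d}$ in $\mathbb K$ with finite norm $$\|x\|=\Big\|\Big(\sum_{I\in\mathcal R_d}\big|x_I\,|I|^{-1/p}\mathbf 1_I\big|^q\Big)^{1/q}\Big\|_{L^p([0,1]^d)},$$ and let $\{e_I\}_{I\in\mathcal R_d}$ be its canonical basis. Let $\sigma_N(x)$ denote the distance from $x$ to the set of linear combinations of at most $N$ of the vectors $e_I$. A run of the Weak Chebyshev Greedy Algorithm (WCGA) with parameter $\tau$ on $x$ is any sequence obtained as follows. Put $G_0(x)=0$. If $x_n:=x-G_n(x)\neq 0$, let $F_{x_n}$ be a norming functional of $x_n$ (that is,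 $\|F_{x_n}\|=1$ and $F_{x_n}(x_n)=\|x_n\|$), pick any $I^{(n+1)}\in\mathcal R_d$ with $|F_{x_n}(e_{I^{(n+1)}})|\ge\tau\sup_{I}|F_{x_n}(e_I)|$, and let $G_{n+1}(x)$ be any element of $\operatorname{span}\{e_{I^{(1)}},\dots,e_{I^{(n+1)}}\}$ at minimal distance from $x$. If $x_n=0$, put $G_{n+1}(x)=G_n(x)$. Define $$h(p,q;d)=(d-1)\Big(\frac1p-\frac1q\Big)_+,\qquad \alpha(p,q)=\begin{cases}1,& p\le q,\\ q'/p',& q\le p.\end{cases}$$ **Theorem.** There is a universal constant $C\ge1$ such that for all $d$, $p$, $q$, $\tau$ as above there is $c=c(p,q,d,\tau)>0$ for which the function $$\phi(N)=\Big\lfloor c\,(1+\log N)^{p'\,h(p,q;d)}\,N^{\alpha(p,q)}\Big\rfloor$$ satisfies $$\|x-G_{\phi(N)}(x)\|\le C\,\sigma_N(x)\qquad\text{for all } N\ge1,\ x\in\mathfrak f_{p,q}(\mathcal R_d),$$ and every run of the WCGA with parameter $\tau$ on $x$. -/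

import Mathlib

open MeasureTheory
open scoped ENNReal

noncomputable section

namespace Greedy

/-! ### Best `N`-term approximation and the Weak Chebyshev Greedy Algorithm -/

section General

variable {𝕜 E ι : Type*} [RCLike 𝕜] [NormedAddCommGroup E] [NormedSpace 𝕜 E]

/-- The set `Σ_N` of linear combinations of at most `N` elements of the dictionary `φ`. -/
def sparse (𝕜 : Type*) {E ι : Type*} [RCLike 𝕜] [NormedAddCommGroup E] [NormedSpace 𝕜 E]
    (φ : ι → E) (N : ℕ) : Set E :=
  {y | ∃ (A : Finset ι) (a : ι → 𝕜), A.card ≤ N ∧ y = ∑ i ∈ A, a i • φ i}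

/-- The error of best `N`-term approximation: the distance from `f` to `Σ_N`
(a set that always contains `0`). -/
def sigma (𝕜 : Type*) {E ι : Type*} [RCLike 𝕜] [NormedAddCommGroup E] [NormedSpace 𝕜 E]
    (φ : ι → E) (N : ℕ) (f : E) : ℝ :=
  Metric.infDist f (sparse 𝕜 φ N)

/-- `F` is a norming functional of `f`. -/
def IsNorming (F : StrongDual 𝕜 E) (f : E) : Prop :=
  ‖F‖ = 1 ∧ F f = ((‖f‖ : ℝ) : 𝕜)

/-- `G 0 = 0, G 1, G 2, …` are the approximants of a run of the Weak Chebyshev Greedy Algorithm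
with weakness parameter `τ`, applied to `f` with respect to the dictionary `φ`; the element
selected at step `n + 1` is `φ (i n)`.  The remainder after `n` steps is `f - G n`, and the
process stops (the approximant no longer changes) once it vanishes.  Neither the selected elements
nor the approximants need be determined by `f`: every admissible choice is a run. -/
structure IsWCGA (𝕜 : Type*) {E ι : Type*} [RCLike 𝕜] [NormedAddCommGroup E] [NormedSpace 𝕜 E]
    (φ : ι → E) (τ : ℝ) (f : E) (i : ℕ → ι) (G : ℕ → E) : Prop where
  zero : G 0 = 0
  /-- The selected element satisfies `|F (φ (i n))| ≥ τ * sup_j |F (φ j)|`. -/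
  select : ∀ n, f - G n ≠ 0 → ∃ F : StrongDual 𝕜 E, IsNorming F (f - G n) ∧
    ∀ j, τ * ‖F (φ j)‖ ≤ ‖F (φ (i n))‖
  mem_span : ∀ n, f - G n ≠ 0 →
    G (n + 1) ∈ Submodule.span 𝕜 ((fun m => φ (i m)) '' Set.Iic n)
  best : ∀ n, f - G n ≠ 0 → ‖f - G (n + 1)‖ =
    Metric.infDist f (Submodule.span 𝕜 ((fun m => φ (i m)) '' Set.Iic n) : Set E)
  halt : ∀ n, f - G n = 0 → G (n + 1) = G n

end General

/-! ### Dyadic rectangles -/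

/-- The pair `⟨j, k⟩`, `0 ≤ k < 2 ^ j`, stands for the dyadic interval `2⁻ʲ (k + [0, 1))`;
different pairs give different intervals. -/
abbrev DyadicInterval : Type := Σ j : ℕ, Fin (2 ^ j)

namespace DyadicInterval

def toSet (J : DyadicInterval) : Set ℝ :=
  Set.Ico (((J.2 : ℕ) : ℝ) / 2 ^ J.1) ((((J.2 : ℕ) : ℝ) + 1) / 2 ^ J.1)

end DyadicInterval

/-- The dyadic rectangles `I = I_1 × … × I_d ⊂ [0, 1]^d`. -/
abbrev DyadicRect (d : ℕ) : Type := Fin d → DyadicInterval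

namespace DyadicRect

variable {d : ℕ}

def toSet (I : DyadicRect d) : Set (Fin d → ℝ) := Set.univ.pi fun i => (I i).toSet

/-- The measure `|I|`, as the product of the side lengths (see `volume_toSet`). -/
def meas (I : DyadicRect d) : ℝ := ∏ i, ((2 : ℝ) ^ (I i).1)⁻¹

lemma meas_pos (I : DyadicRect d) : 0 < I.meas := Finset.prod_pos fun i _ => by positivity

lemma measurableSet_toSet (I : DyadicRect d) : MeasurableSet I.toSet :=
  MeasurableSet.univ_pi fun _ => measurableSet_Ico

lemma volume_toSet (I : DyadicRect d) : volume I.toSet = ENNReal.ofReal I.meas := by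
  unfold toSet meas
  rw [volume_pi_pi, ENNReal.ofReal_prod_of_nonneg (fun i _ => by positivity)]
  refine Finset.prod_congr rfl fun i _ => ?_
  change volume (Set.Ico _ _) = _
  rw [Real.volume_Ico]
  congr 1
  field_simp
  ring

lemma toSet_subset (I : DyadicRect d) : I.toSet ⊆ Set.Icc 0 1 := by
  intro u hu
  have key : ∀ i, 0 ≤ u i ∧ u i ≤ 1 := by
    intro i
    have h : u i ∈ Set.Ico _ _ := hu i (Set.mem_univ i)
    rw [Set.mem_Ico] at h
    have hk : (((I i).2 : ℕ) : ℝ) + 1 ≤ 2 ^ (I i).1 := by exact_mod_cast (I i).2.2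
    refine ⟨le_trans (by positivity) h.1, h.2.le.trans ?_⟩
    rw [div_le_one (by positivity)]
    exact hk
  exact ⟨fun i => (key i).1, fun i => (key i).2⟩

/-- The `L^p`-normalized characteristic function `|I|^(-1/p) 1_I`. -/
def normInd (p : ℝ) (I : DyadicRect d) : (Fin d → ℝ) → ℝ≥0∞ :=
  I.toSet.indicator fun _ => ENNReal.ofReal (I.meas ^ (-1 / p))

lemma measurable_normInd (p : ℝ) (I : DyadicRect d) : Measurable (I.normInd p) :=
  measurable_const.indicator I.measurableSet_toSet

end DyadicRect

/-! ### The spaces `f_{p,q}` -/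

section Space

variable {𝕜 : Type*} [RCLike 𝕜] {d : ℕ}

/-- The function `S_q x = (∑_I |x_I 1_{I,p}|^q)^(1/q)`. -/
def sqFun (p q : ℝ) (x : DyadicRect d → 𝕜) (u : Fin d → ℝ) : ℝ≥0∞ :=
  (∑' I : DyadicRect d, (‖x I‖ₑ * I.normInd p u) ^ q) ^ (1 / q)

/-- The norm of a sequence, `‖S_q x‖_{L^p([0,1]^d)}`, with values in `[0, ∞]`. -/
def fpqENorm (p q : ℝ) (x : DyadicRect d → 𝕜) : ℝ≥0∞ :=
  (∫⁻ u in Set.Icc (0 : Fin d → ℝ) 1, sqFun p q x u ^ p) ^ (1 / p)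

lemma measurable_sqFun (p q : ℝ) (x : DyadicRect d → 𝕜) : Measurable (sqFun p q x) := by
  unfold sqFun
  refine Measurable.pow_const (Measurable.tsum fun I => ?_) _
  exact Measurable.pow_const ((I.measurable_normInd p).const_mul _) _

lemma sqFun_add_le {p q : ℝ} (hq : 1 < q) (x y : DyadicRect d → 𝕜) (u : Fin d → ℝ) :
    sqFun p q (x + y) u ≤ sqFun p q x u + sqFun p q y u := by
  let _ : MeasurableSpace (DyadicRect d) := ⊤
  have h := ENNReal.lintegral_Lp_add_le (μ := (Measure.count : Measure (DyadicRect d))) (p := q)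
    (f := fun I => ‖x I‖ₑ * I.normInd p u) (g := fun I => ‖y I‖ₑ * I.normInd p u)
    (measurable_from_top).aemeasurable (measurable_from_top).aemeasurable hq.le
  simp only [lintegral_count, Pi.add_apply] at h
  refine le_trans ?_ h
  unfold sqFun
  gcongr with I
  rw [← add_mul]
  gcongr
  exact enorm_add_le _ _

lemma fpqENorm_add_le {p q : ℝ} (hp : 1 < p) (hq : 1 < q) (x y : DyadicRect d → 𝕜) :
    fpqENorm p q (x + y) ≤ fpqENorm p q x + fpqENorm p q y := by
  refine le_trans ?_ (ENNReal.lintegral_Lp_add_le (measurable_sqFun p q x).aemeasurable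
    (measurable_sqFun p q y).aemeasurable hp.le)
  unfold fpqENorm
  gcongr with u
  exact sqFun_add_le hq x y u

lemma fpqENorm_smul {p q : ℝ} (hp : 1 < p) (hq : 1 < q) (a : 𝕜) (x : DyadicRect d → 𝕜) :
    fpqENorm p q (a • x) = ‖a‖ₑ * fpqENorm p q x := by
  have hp0 : 0 < p := by linarith
  have hq0 : 0 < q := by linarith
  have h1 : ∀ u, sqFun p q (a • x) u = ‖a‖ₑ * sqFun p q x u := by
    intro u
    unfold sqFun
    simp only [Pi.smul_apply, smul_eq_mul, enorm_mul, mul_assoc]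
    simp_rw [ENNReal.mul_rpow_of_nonneg ‖a‖ₑ _ hq0.le]
    rw [ENNReal.tsum_mul_left, ENNReal.mul_rpow_of_nonneg _ _ (by positivity), ← ENNReal.rpow_mul,
      mul_one_div_cancel hq0.ne', ENNReal.rpow_one]
  unfold fpqENorm
  simp_rw [h1, ENNReal.mul_rpow_of_nonneg _ _ hp0.le]
  rw [lintegral_const_mul _ ((measurable_sqFun p q x).pow_const _),
    ENNReal.mul_rpow_of_nonneg _ _ (by positivity), ← ENNReal.rpow_mul,
    mul_one_div_cancel hp0.ne', ENNReal.rpow_one]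

lemma fpqENorm_zero {p q : ℝ} (hp : 1 < p) (hq : 1 < q) :
    fpqENorm p q (0 : DyadicRect d → 𝕜) = 0 := by
  have h := fpqENorm_smul hp hq (0 : 𝕜) (0 : DyadicRect d → 𝕜)
  simpa using h

lemma fpqENorm_single {p q : ℝ} (hp : 1 < p) (hq : 1 < q) (I : DyadicRect d) :
    fpqENorm p q (Pi.single I (1 : 𝕜)) = 1 := by
  classical
  have hp0 : 0 < p := by linarith
  have hq0 : 0 < q := by linarith
  have h1 : ∀ u, sqFun p q (Pi.single I (1 : 𝕜)) u = I.normInd p u := by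
    intro u
    unfold sqFun
    rw [tsum_eq_single I]
    · rw [← ENNReal.rpow_mul, mul_one_div_cancel hq0.ne', ENNReal.rpow_one]
      simp
    · intro J hJ
      simp [Pi.single_eq_of_ne hJ, hq0]
  unfold fpqENorm
  simp_rw [h1]
  have h2 : ∀ u, I.normInd p u ^ p = I.toSet.indicator (fun _ => ENNReal.ofReal I.meas⁻¹) u := by
    intro u
    unfold DyadicRect.normInd
    by_cases hu : u ∈ I.toSet
    · simp only [Set.indicator_of_mem hu]
      rw [ENNReal.ofReal_rpow_of_nonneg (Real.rpow_nonneg I.meas_pos.le _) hp0.le,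
        ← Real.rpow_mul I.meas_pos.le, div_mul_cancel₀ _ hp0.ne', Real.rpow_neg_one]
    · simp [Set.indicator_of_notMem hu, hp0]
  simp_rw [h2]
  rw [lintegral_indicator_const I.measurableSet_toSet,
    Measure.restrict_apply I.measurableSet_toSet, Set.inter_eq_left.mpr I.toSet_subset,
    I.volume_toSet, ← ENNReal.ofReal_mul (inv_nonneg.mpr I.meas_pos.le),
    inv_mul_cancel₀ I.meas_pos.ne']
  simp

lemma eq_zero_of_fpqENorm_eq_zero {p q : ℝ} (hp : 1 < p) (hq : 1 < q) {x : DyadicRect d → 𝕜}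
    (h : fpqENorm p q x = 0) : x = 0 := by
  have hp0 : 0 < p := by linarith
  have hq0 : 0 < q := by linarith
  funext I
  by_contra hI
  unfold fpqENorm at h
  rw [ENNReal.rpow_eq_zero_iff_of_pos (by positivity),
    lintegral_eq_zero_iff ((measurable_sqFun p q x).pow_const _)] at h
  have hsub : I.toSet ⊆ {u | ¬ (sqFun p q x u ^ p = (0 : (Fin d → ℝ) → ℝ≥0∞) u)} := by
    intro u hu h0
    rw [Pi.zero_apply, ENNReal.rpow_eq_zero_iff_of_pos hp0] at h0
    unfold sqFun at h0
    rw [ENNReal.rpow_eq_zero_iff_of_pos (by positivity), ENNReal.tsum_eq_zero] at h0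
    have h3 := h0 I
    rw [ENNReal.rpow_eq_zero_iff_of_pos hq0, mul_eq_zero] at h3
    rcases h3 with h3 | h3
    · exact hI (by simpa using h3)
    · rw [DyadicRect.normInd, Set.indicator_of_mem hu, ENNReal.ofReal_eq_zero] at h3
      exact absurd h3 (not_le.mpr (Real.rpow_pos_of_pos I.meas_pos _))
  have h4 : (volume.restrict (Set.Icc (0 : Fin d → ℝ) 1)) I.toSet = 0 :=
    measure_mono_null hsub (ae_iff.mp h)
  rw [Measure.restrict_apply I.measurableSet_toSet, Set.inter_eq_left.mpr I.toSet_subset,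
    I.volume_toSet, ENNReal.ofReal_eq_zero] at h4
  exact absurd h4 (not_le.mpr I.meas_pos)

end Space

/-- The vector space of all sequences whose `f_{p,q}` norm is finite. -/
def fpqSubmodule (𝕜 : Type*) [RCLike 𝕜] (d : ℕ) (p q : ℝ) [hp : Fact (1 < p)] [hq : Fact (1 < q)] :
    Submodule 𝕜 (DyadicRect d → 𝕜) where
  carrier := {x | fpqENorm p q x < ∞}
  zero_mem' := by
    rw [Set.mem_ofPred_eq, fpqENorm_zero hp.out hq.out]; exact ENNReal.zero_lt_top
  add_mem' := fun hx hy =>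
    (fpqENorm_add_le hp.out hq.out _ _).trans_lt (ENNReal.add_lt_top.mpr ⟨hx, hy⟩)
  smul_mem' := fun a x hx => by
    rw [Set.mem_ofPred_eq, fpqENorm_smul hp.out hq.out]
    exact ENNReal.mul_lt_top enorm_lt_top hx

/-- The space `f_{p,q}(R_d)`, `1 < p, q < ∞`, of sequences over `𝕜` (a type synonym, so that it
carries the norm topology and not the product topology). -/
def Fpq (𝕜 : Type*) [RCLike 𝕜] (d : ℕ) (p q : ℝ) [Fact (1 < p)] [Fact (1 < q)] : Type _ :=
  fpqSubmodule 𝕜 d p q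

namespace Fpq

variable {𝕜 : Type*} [RCLike 𝕜] {d : ℕ} {p q : ℝ} [hp : Fact (1 < p)] [hq : Fact (1 < q)]

instance : AddCommGroup (Fpq 𝕜 d p q) := inferInstanceAs (AddCommGroup (fpqSubmodule 𝕜 d p q))

instance : Module 𝕜 (Fpq 𝕜 d p q) := inferInstanceAs (Module 𝕜 (fpqSubmodule 𝕜 d p q))

/-- The underlying sequence. -/
def coord (x : Fpq 𝕜 d p q) : DyadicRect d → 𝕜 := x.1

instance : Norm (Fpq 𝕜 d p q) := ⟨fun x => (fpqENorm p q x.coord).toReal⟩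

lemma norm_def (x : Fpq 𝕜 d p q) : ‖x‖ = (fpqENorm p q x.coord).toReal := rfl

lemma core : NormedSpace.Core 𝕜 (Fpq 𝕜 d p q) where
  norm_nonneg x := ENNReal.toReal_nonneg
  norm_smul a x := by
    have h : fpqENorm p q (a • x).coord = ‖a‖ₑ * fpqENorm p q x.coord :=
      fpqENorm_smul hp.out hq.out a x.coord
    rw [norm_def, norm_def, h, ENNReal.toReal_mul, toReal_enorm]
  norm_triangle x y := by
    have hx : fpqENorm p q x.coord ≠ ∞ := ne_of_lt x.2
    have hy : fpqENorm p q y.coord ≠ ∞ := ne_of_lt y.2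
    rw [norm_def, norm_def, norm_def, ← ENNReal.toReal_add hx hy]
    exact ENNReal.toReal_mono (ENNReal.add_ne_top.mpr ⟨hx, hy⟩)
      (fpqENorm_add_le hp.out hq.out x.coord y.coord)
  norm_eq_zero_iff x := by
    rw [norm_def, ENNReal.toReal_eq_zero_iff]
    constructor
    · rintro (h | h)
      · exact Subtype.ext (eq_zero_of_fpqENorm_eq_zero hp.out hq.out h)
      · exact absurd h (ne_of_lt x.2)
    · rintro rfl
      exact Or.inl (fpqENorm_zero hp.out hq.out)

instance : NormedAddCommGroup (Fpq 𝕜 d p q) := NormedAddCommGroup.ofCore core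

instance : NormedSpace 𝕜 (Fpq 𝕜 d p q) := NormedSpace.ofCore core

/-- The canonical basis vector `e_I`. -/
def basis (𝕜 : Type*) [RCLike 𝕜] (d : ℕ) (p q : ℝ) [hp : Fact (1 < p)] [hq : Fact (1 < q)]
    (I : DyadicRect d) : Fpq 𝕜 d p q :=
  ⟨Pi.single I 1, by
    change fpqENorm p q _ < ∞
    rw [fpqENorm_single hp.out hq.out]; exact ENNReal.one_lt_top⟩

lemma norm_basis (I : DyadicRect d) : ‖basis 𝕜 d p q I‖ = 1 := by
  rw [norm_def]
  have h : fpqENorm p q (basis 𝕜 d p q I).coord = 1 := fpqENorm_single hp.out hq.out I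
  rw [h, ENNReal.toReal_one]

end Fpq

/-! ### The exponents -/

/-- `h(p,q;d) = (d-1)(1/p - 1/q)_+`. -/
def hExp (p q : ℝ) (d : ℕ) : ℝ := ((d : ℝ) - 1) * max (1 / p - 1 / q) 0

/-- `α(p,q) = 1` if `p ≤ q`, and `α(p,q) = q'/p'` if `q ≤ p`. -/
def alphaExp (p q : ℝ) : ℝ :=
  if p ≤ q then 1 else Real.conjExponent q / Real.conjExponent p

/-- `φ(N) = ⌊c (1 + log N)^{p' h(p,q;d)} N^{α(p,q)}⌋`. -/
def phiFun (p q : ℝ) (d : ℕ) (c : ℝ) (N : ℕ) : ℕ :=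
  ⌊c * (1 + Real.log N) ^ (Real.conjExponent p * hExp p q d) * (N : ℝ) ^ alphaExp p q⌋₊

end Greedy

end

/-! The norm depends only on the moduli of the coordinates and is strictly monotone in each of them.
Hence the Chebyshev step just deletes the selected coordinates (`sub_eq_restr_of_best`), every
remainder is the restriction of `x` to a set `S n` that decreases with `n`, and `σ_N(x)` is up to
`ε` the norm of `x` off a set `A` with `|A| ≤ N`.

One step. Put `s = min p q`, let `s'` be its conjugate exponent, and let `Φ = |F(e_I)|` for a
norming functional `F` of the remainder. The space has an upper `s`-estimate, so `|x_I|` must be at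
least a multiple of `Φ^(1/(s-1)) ‖x‖`; moving along `e_I` by `|x_I|` raises the norm at a rate at
least `Φ`, and a comparison of enlarging with deleting a coordinate shows that deleting `x_I`
multiplies `‖x‖^p` by at most `1 - κ Φ^s'` (`norm_restr_compl_rpow_le`). If a set `B` carries half
of the norm, Hölder's inequality bounds `Φ^s'` below by a multiple of `1/(g(N) |B|)`, where `g` is
`growth` (`norm_restr_compl_rpow_le_of_greedy`). The power of `N` or of the logarithm in `g` comes
from the norm of indicator sums in the dual space; for `p < q` this is a count of the rectangles
through a point, `d - 1` of whose side lengths are free once the measure is fixed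
(`lintegral_sum_normInd_rpow_le`).

Counting. So about `g(N) |B|` steps either match the removal of `B` or divide the norm by 4
(`le_max_of_decay`). `greedy_steps_le` turns this into a total linear in `|A|`: stretches of
doubling length are tried, and a stretch that only yields the drop by 4 must have deleted so many
elements of `A` that these pay for the time spent. -/

noncomputable section

namespace Greedy

/-! ### Counting the steps of a greedy process -/

section Combinatorial

variable {ι : Type*}

/-- A monotone and subadditive set function `ν` is evaluated on a decreasing sequence of sets `S n`.
Suppose that removing a subset `B` of `A` from `S n` is matched, up to the factor `2`, after
`T * |B|` steps, unless `ν` has dropped by the factor `4` meanwhile. Then `4 * T * |A|` steps match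
the removal of `A`. -/
theorem greedy_steps_le [DecidableEq ι] {ν : Set ι → ℝ} (hmono : Monotone ν)
    (hadd : ∀ s t, ν (s ∪ t) ≤ ν s + ν t) (hnonneg : ∀ s, 0 ≤ ν s)
    {S : ℕ → Set ι} (hS : Antitone S) (A : Finset ι) (T : ℕ)
    (h : ∀ (n : ℕ) (B : Finset ι) (M : ℕ), B ⊆ A → B.card ≤ M →
      ν (S (n + T * M)) ≤ max (2 * ν (S n \ B)) (ν (S n) / 4)) :
    ν (S (4 * T * A.card)) ≤ 2 * ν (Aᶜ : Set ι) := by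
  classical
  set ε := ν (Aᶜ : Set ι) with hε
  have hε0 : 0 ≤ ε := hnonneg _
  -- Strong induction on the number of elements of `A` still present. The starting time is
  -- arbitrary, so that the argument can restart once enough of them are gone.
  have key : ∀ k n, (A.filter (· ∈ S n)).card = k → ν (S (n + 4 * T * k)) ≤ 2 * ε := by
    intro k
    induction k using Nat.strong_induction_on with
    | _ k ih =>
    intro n hk
    by_contra! hcon
    have hbig : ∀ n', n' ≤ n + 4 * T * k → 2 * ε < ν (S n') := fun n' hn' =>
      hcon.trans_le (hmono (hS hn'))
    -- Here `T * (2 ^ j - 1)` is the total length of the stretches `T * 2 ^ i`, `i < j`. Stretch `i`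
    -- suffices for sets of at most `2 ^ i` elements.
    have Q : ∀ j, 2 ^ j ≤ 4 * k → ∀ B ⊆ A, 2 * B.card ≤ 2 ^ j →
        ν (S (n + T * (2 ^ j - 1))) ≤ 2 * ν (S n \ B) := by
      intro j
      induction j with
      | zero =>
        intro _ B _ hB
        have : B.card = 0 := by omega
        rw [Finset.card_eq_zero] at this
        subst this
        have := hnonneg (S n)
        simp only [pow_zero, Nat.sub_self, mul_zero, add_zero, Finset.coe_empty, Set.sdiff_empty]
        linarith
      | succ j ihj =>
        intro hj B hBA hB
        have hpow : 2 ^ (j + 1) = 2 * 2 ^ j := pow_succ' 2 j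
        have h1 : 1 ≤ 2 ^ j := Nat.one_le_two_pow
        have hn2 : n + T * (2 ^ (j + 1) - 1) = n + T * (2 ^ j - 1) + T * 2 ^ j := by
          rw [add_assoc, ← mul_add]; congr 2; omega
        set n1 := n + T * (2 ^ j - 1) with hn1
        rw [hn2]
        set n2 := n1 + T * 2 ^ j with hn2'
        have hnn2 : n ≤ n2 := by omega
        have hn2k : n2 ≤ n + 4 * T * k := by
          rw [← hn2, mul_right_comm, mul_comm _ T]
          have : T * (2 ^ (j + 1) - 1) ≤ T * (4 * k) := Nat.mul_le_mul_left _ (by omega)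
          omega
        by_contra! hlt
        have hstep := h n1 B (2 ^ j) hBA (by omega)
        have hmon1 : ν (S n1 \ B) ≤ ν (S n \ B) :=
          hmono (Set.sdiff_subset_sdiff_left (hS (by omega)))
        have hquarter : ν (S n2) ≤ ν (S n1) / 4 := by
          rcases le_max_iff.mp hstep with h' | h'
          · linarith
          · exact h'
        -- `C` is the part of `A` deleted up to time `n2`. If it is small, the previous scale
        -- applied to `C` gives `ν (S n1) ≤ 2 (ν (S n2) + ε)`, and the drop by 4 then forces `ν (S
        -- n2) ≤ ε`. If it is large, the elapsed time is at most `4 * T * |C|` and the outer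
        -- induction restarts at `n2`.
        set C := A.filter (fun a => a ∈ S n ∧ a ∉ S n2) with hC
        have hsplit : (A.filter (· ∈ S n2)).card + C.card = k := by
          rw [← hk, ← Finset.card_union_of_disjoint]
          · congr 1
            ext a
            simp only [hC, Finset.mem_union, Finset.mem_filter]
            have := @hS n n2 hnn2 a
            tauto
          · rw [Finset.disjoint_left]
            intro a
            simp only [hC, Finset.mem_filter]
            tauto
        by_cases hcap : 2 * C.card ≤ 2 ^ j
        · have h2 := ihj (by omega) C (Finset.filter_subset _ _) hcap
          have h3 : ν (S n \ C) ≤ ν (S n2) + ε := by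
            refine (hmono ?_).trans (hadd _ _)
            intro a ha
            by_cases haA : a ∈ A
            · left
              by_contra h'
              exact ha.2 (by simpa [hC] using ⟨haA, ha.1, h'⟩)
            · right; simpa using haA
          have := hbig n2 hn2k
          linarith
        · push Not at hcap
          have hCpos : 0 < C.card := by omega
          have h2 := ih (k - C.card) (by omega) n2 (by omega)
          refine absurd (hbig _ ?_) (not_lt.mpr h2)
          obtain ⟨r, hr⟩ : ∃ r, k = C.card + r := ⟨k - C.card, by omega⟩
          have e1 : k - C.card = r := by omega
          rw [e1, hr, ← hn2]
          have : T * (2 ^ (j + 1) - 1) ≤ T * (4 * C.card) := Nat.mul_le_mul_left _ (by omega)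
          nlinarith
    rcases Nat.eq_zero_or_pos k with rfl | hkpos
    · have hsub : S n ⊆ (Aᶜ : Set ι) := by
        intro a ha haA
        rw [Finset.card_eq_zero] at hk
        have : a ∈ A.filter (· ∈ S n) := Finset.mem_filter.mpr ⟨haA, ha⟩
        rw [hk] at this
        simp at this
      have h1 := hmono hsub
      have h2 := hbig n (by omega)
      linarith
    -- This scale is large enough to treat all of `A ∩ S n` at once, yet fits into `4 * T * k`
    -- steps.
    · obtain ⟨j, hj1, hj2⟩ : ∃ j, 2 * k ≤ 2 ^ j ∧ 2 ^ j ≤ 4 * k := by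
        refine ⟨Nat.log 2 k + 2, ?_, ?_⟩
        · have := Nat.lt_pow_succ_log_self (b := 2) (by norm_num) k
          rw [pow_succ]; omega
        · have := Nat.pow_log_le_self 2 hkpos.ne'
          rw [pow_add]; omega
      have h1 := Q j hj2 (A.filter (· ∈ S n)) (Finset.filter_subset _ _) (by omega)
      have h2 : ν (S n \ (A.filter (· ∈ S n) : Finset ι)) ≤ ε := by
        refine hmono ?_
        intro a ha haA
        exact ha.2 (by simpa using ⟨haA, ha.1⟩)
      have h3 : n + T * (2 ^ j - 1) ≤ n + 4 * T * k := by
        rw [mul_right_comm, mul_comm _ T]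
        have : T * (2 ^ j - 1) ≤ T * (4 * k) := Nat.mul_le_mul_left _ (by omega)
        omega
      linarith [hbig _ h3]
  have h0 := key _ 0 rfl
  refine (hmono (hS ?_)).trans h0
  rw [zero_add]
  exact Nat.mul_le_mul_left _ (Finset.card_filter_le _ _)

/-- If a norm `ν (S n)` decreases by a factor `1 - δ` in the `p`-th power as long as it exceeds
`2 * ν (S n \ B)`, then `K` steps with `p * log 4 ≤ δ * K` bring it below `2 * ν (S n \ B)` or
reduce it by the factor `4`. -/
theorem le_max_of_decay {ν : Set ι → ℝ} (hmono : Monotone ν) (hnonneg : ∀ s, 0 ≤ ν s)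
    {S : ℕ → Set ι} (hS : Antitone S) {p δ : ℝ} (hp : 0 < p) (hδ : δ ≤ 1) {B : Set ι}
    (h : ∀ n, 2 * ν (S n \ B) < ν (S n) → ν (S (n + 1)) ^ p ≤ (1 - δ) * ν (S n) ^ p)
    {K : ℕ} (hK : p * Real.log 4 ≤ δ * K) (n : ℕ) :
    ν (S (n + K)) ≤ max (2 * ν (S n \ B)) (ν (S n) / 4) := by
  by_contra! hcon
  obtain ⟨h1, h2⟩ := max_lt_iff.mp hcon
  -- The decay hypothesis holds at every intermediate time: `ν (S (n + k))` is at least the final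
  -- value, and `ν (S (n + k) \ B)` is at most the initial one.
  have hdec : ∀ k ≤ K, ν (S (n + k)) ^ p ≤ (1 - δ) ^ k * ν (S n) ^ p := by
    intro k
    induction k with
    | zero => intro _; simp
    | succ k ih =>
      intro hk
      have h3 : 2 * ν (S (n + k) \ B) < ν (S (n + k)) := by
        have a1 : ν (S (n + k) \ B) ≤ ν (S n \ B) :=
          hmono (Set.sdiff_subset_sdiff_left (hS (by omega)))
        have a2 : ν (S (n + K)) ≤ ν (S (n + k)) := hmono (hS (by omega))
        linarith
      calc ν (S (n + (k + 1))) ^ p ≤ (1 - δ) * ν (S (n + k)) ^ p := h _ h3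
        _ ≤ (1 - δ) * ((1 - δ) ^ k * ν (S n) ^ p) :=
          mul_le_mul_of_nonneg_left (ih (by omega)) (by linarith)
        _ = _ := by rw [pow_succ]; ring
  have h3 := hdec K le_rfl
  have h4 : (1 - δ) ^ K ≤ (1 / 4 : ℝ) ^ p := by
    calc (1 - δ) ^ K ≤ Real.exp (-δ) ^ K :=
          pow_le_pow_left₀ (by linarith) (Real.one_sub_le_exp_neg δ) K
      _ = Real.exp (-(δ * K)) := by rw [← Real.exp_nat_mul]; ring_nf
      _ ≤ Real.exp (Real.log (1 / 4) * p) := by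
          apply Real.exp_le_exp.mpr
          rw [one_div, Real.log_inv]
          linarith
      _ = (1 / 4 : ℝ) ^ p := by rw [Real.rpow_def_of_pos (by norm_num)]
  have h5 : ν (S (n + K)) ^ p ≤ (ν (S n) / 4) ^ p := by
    calc _ ≤ _ := h3
      _ ≤ (1 / 4 : ℝ) ^ p * ν (S n) ^ p :=
        mul_le_mul_of_nonneg_right h4 (Real.rpow_nonneg (hnonneg _) _)
      _ = _ := by
        rw [← Real.mul_rpow (by norm_num) (hnonneg _)]
        congr 1; ring
  rw [Real.rpow_le_rpow_iff (hnonneg _) (by have := hnonneg (S n); positivity) hp] at h5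
  linarith

end Combinatorial

/-! ### Inequalities for powers -/

/-- `(∑ a_i)^m ≤ m ∑ a_i (∑_{a_j ≤ a_i} a_j)^(m-1)`. -/
theorem sum_rpow_le_mul_sum {ι : Type*} [DecidableEq ι] {m : ℝ} (hm : 1 ≤ m) {a : ι → ℝ}
    (s : Finset ι) (ha : ∀ i ∈ s, 0 ≤ a i) :
    (∑ i ∈ s, a i) ^ m ≤
      m * ∑ i ∈ s, a i * (∑ j ∈ s.filter (fun j => a j ≤ a i), a j) ^ (m - 1) := by
  -- When terms are added in increasing order, the inner sum of the newest term is the full sum,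
  -- while the earlier inner sums can only grow.
  induction s using Finset.induction_on_max_value a with
  | empty => simp [Real.zero_rpow (by linarith : m ≠ 0)]
  | insert i s his hmax ih =>
    have ha' : ∀ j ∈ s, 0 ≤ a j := fun j hj => ha j (Finset.mem_insert_of_mem hj)
    have hi : 0 ≤ a i := ha i (Finset.mem_insert_self _ _)
    have hs : 0 ≤ ∑ j ∈ s, a j := Finset.sum_nonneg ha'
    have hfull : (insert i s).filter (fun j => a j ≤ a i) = insert i s := by
      rw [Finset.filter_true_of_mem]
      intro j hj
      rcases Finset.mem_insert.mp hj with rfl | hj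
      · exact le_rfl
      · exact hmax j hj
    rw [Finset.sum_insert his, Finset.sum_insert his, hfull, Finset.sum_insert his, mul_add]
    -- The tangent bound for the convex power at the larger endpoint, obtained from Bernoulli's
    -- inequality.
    have h1 : (a i + ∑ j ∈ s, a j) ^ m ≤
        m * (a i * (a i + ∑ j ∈ s, a j) ^ (m - 1)) + (∑ j ∈ s, a j) ^ m := by
      set r := ∑ j ∈ s, a j
      rcases (add_nonneg hi hs).eq_or_lt with h0 | hpos
      · have hr : r = 0 := by linarith
        have hai : a i = 0 := by linarith
        simp [hr, hai, Real.zero_rpow (by linarith : m ≠ 0)]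
      · have hb := one_add_mul_self_le_rpow_one_add (s := -(a i / (a i + r)))
          (by rw [neg_le_neg_iff, div_le_one hpos]; linarith) hm
        have e1 : 1 + -(a i / (a i + r)) = r / (a i + r) := by field_simp; ring
        rw [e1, Real.div_rpow hs hpos.le, le_div_iff₀ (Real.rpow_pos_of_pos hpos m)] at hb
        have e2 : (a i + r) ^ m = (a i + r) ^ (m - 1) * (a i + r) := by
          rw [← Real.rpow_add_one hpos.ne']; ring_nf
        have e3 : (1 + m * -(a i / (a i + r))) * (a i + r) ^ m =
            (a i + r) ^ m - m * (a i * (a i + r) ^ (m - 1)) := by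
          rw [e2]; field_simp; ring
        linarith
    refine h1.trans (add_le_add_right ((ih ha').trans ?_) _)
    refine mul_le_mul_of_nonneg_left (Finset.sum_le_sum fun j hj => ?_) (by linarith)
    refine mul_le_mul_of_nonneg_left (Real.rpow_le_rpow (Finset.sum_nonneg fun l hl =>
      ha' l (Finset.mem_filter.mp hl).1) (Finset.sum_le_sum_of_subset_of_nonneg
        (Finset.filter_subset_filter _ (Finset.subset_insert _ _)) fun l hl _ =>
        ha l (Finset.mem_filter.mp hl).1) (by linarith)) (ha' j hj)

/-- For `m ≤ 1` use concavity, `r + b` being a convex combination of `r` and `r + K b`; this gives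
`C = K - 1`. For `m ≥ 1` put `s = r + b` and `θ = b / s`: convexity between `s` and `K s` bounds `(r
+ K b)^m`, and `(1 - θ)^m ≤ 1 - θ` bounds `r^m`; this gives `C = K^m - 1`. -/
lemma add_mul_rpow_add_mul_rpow_le {m K : ℝ} (hm : 0 < m) (hK : 1 < K) :
    ∃ C : ℝ, 0 < C ∧ ∀ r b : ℝ, 0 ≤ r → 0 ≤ b →
      (r + K * b) ^ m + C * r ^ m ≤ (1 + C) * (r + b) ^ m := by
  rcases le_total m 1 with hm1 | hm1
  · refine ⟨K - 1, by linarith, fun r b hr hb => ?_⟩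
    have h := (Real.concaveOn_rpow hm.le hm1).2
      (show r + K * b ∈ Set.Ici 0 by simp only [Set.mem_Ici]; positivity) (show r ∈ Set.Ici 0 from hr)
      (show 0 ≤ 1 / K by positivity)
      (show 0 ≤ 1 - 1 / K by rw [sub_nonneg, div_le_one] <;> linarith) (by ring)
    simp only [smul_eq_mul] at h
    have e : 1 / K * (r + K * b) + (1 - 1 / K) * r = r + b := by field_simp; ring
    rw [e] at h
    have h2 := mul_le_mul_of_nonneg_left h (by linarith : (0 : ℝ) ≤ K)
    have e2 : K * (1 / K * (r + K * b) ^ m + (1 - 1 / K) * r ^ m) =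
      (r + K * b) ^ m + (K - 1) * r ^ m := by field_simp
    rw [e2] at h2
    linarith
  · have hKm : 1 < K ^ m := Real.one_lt_rpow hK hm
    refine ⟨K ^ m - 1, by linarith, fun r b hr hb => ?_⟩
    rcases (add_nonneg hr hb).eq_or_lt with h0 | hpos
    · have hr : r = 0 := by linarith
      have hb : b = 0 := by linarith
      simp [hr, hb, Real.zero_rpow hm.ne']
    · set s := r + b
      set θ := b / s
      have hθ0 : 0 ≤ θ := by positivity
      have hθ1 : θ ≤ 1 := by rw [div_le_one hpos]; linarith
      have h := (convexOn_rpow hm1).2 (show s ∈ Set.Ici 0 from hpos.le)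
        (show K * s ∈ Set.Ici 0 by simp only [Set.mem_Ici]; positivity)
        (show 0 ≤ 1 - θ by linarith) hθ0 (by ring)
      simp only [smul_eq_mul] at h
      have hbs : b = θ * s := by simp only [θ]; field_simp
      have hrs : r = (1 - θ) * s := by rw [sub_mul, ← hbs]; simp [s]
      have e : (1 - θ) * s + θ * (K * s) = r + K * b := by rw [hrs, hbs]; ring
      rw [e, Real.mul_rpow (by linarith) hpos.le] at h
      have h2 : r ^ m ≤ (1 - θ) * s ^ m := by
        rw [hrs, Real.mul_rpow (by linarith) hpos.le]
        refine mul_le_mul_of_nonneg_right ?_ (by positivity)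
        exact Real.rpow_le_self_of_le_one (by linarith) (by linarith) hm1
      have h3 := mul_le_mul_of_nonneg_left h2 (by linarith : 0 ≤ K ^ m - 1)
      nlinarith [h, h3]

/-- The increment of `t ↦ (r + t b)^m` over `[1, K]` is controlled by that over `[0, 1]`. -/
theorem ENNReal.add_mul_rpow_add_mul_rpow_le {m K : ℝ} (hm : 0 < m) (hK : 1 < K) :
    ∃ C : ℝ, 0 < C ∧ ∀ r b : ℝ≥0∞,
      (r + ENNReal.ofReal K * b) ^ m + ENNReal.ofReal C * r ^ m ≤
        ENNReal.ofReal (1 + C) * (r + b) ^ m := by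
  obtain ⟨C, hC, h⟩ := Greedy.add_mul_rpow_add_mul_rpow_le hm hK
  refine ⟨C, hC, fun r b => ?_⟩
  by_cases hr : r = ∞
  · have : ENNReal.ofReal (1 + C) ≠ 0 := by simp; linarith
    simp [hr, ENNReal.top_rpow_of_pos hm, ENNReal.mul_top this]
  by_cases hb : b = ∞
  · have : ENNReal.ofReal (1 + C) ≠ 0 := by simp; linarith
    simp [hb, ENNReal.top_rpow_of_pos hm, ENNReal.mul_top this]
  lift r to NNReal using hr
  lift b to NNReal using hb
  have h1 := h r b r.2 b.2
  rw [← ENNReal.ofReal_coe_nnreal (p := r), ← ENNReal.ofReal_coe_nnreal (p := b),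
    ← ENNReal.ofReal_mul (by linarith), ← ENNReal.ofReal_add (by positivity) (by positivity),
    ← ENNReal.ofReal_add (by positivity) (by positivity),
    ENNReal.ofReal_rpow_of_nonneg (by positivity) hm.le,
    ENNReal.ofReal_rpow_of_nonneg (by positivity) hm.le,
    ENNReal.ofReal_rpow_of_nonneg (by positivity) hm.le,
    ← ENNReal.ofReal_mul (by positivity), ← ENNReal.ofReal_mul (by positivity),
    ← ENNReal.ofReal_add (by positivity) (by positivity)]
  exact ENNReal.ofReal_le_ofReal h1

/-! ### Geometry of dyadic rectangles -/

lemma DyadicInterval.eq_of_mem {I J : DyadicInterval} {u : ℝ} (hI : u ∈ I.toSet) (hJ : u ∈ J.toSet)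
    (h : I.1 = J.1) : I = J := by
  obtain ⟨j, k⟩ := I
  obtain ⟨j', k'⟩ := J
  obtain rfl : j = j' := h
  have h1 : u ∈ Set.Ico _ _ := hI
  have h2 : u ∈ Set.Ico _ _ := hJ
  simp only [Set.mem_Ico] at h1 h2
  have hp : (0 : ℝ) < 2 ^ j := by positivity
  have a1 := (div_le_iff₀ hp).mp h1.1
  have a2 := (lt_div_iff₀ hp).mp h1.2
  have b1 := (div_le_iff₀ hp).mp h2.1
  have b2 := (lt_div_iff₀ hp).mp h2.2
  have c1 : ((k : ℕ) : ℝ) < (k' : ℕ) + 1 := a1.trans_lt b2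
  have c2 : ((k' : ℕ) : ℝ) < (k : ℕ) + 1 := b1.trans_lt a2
  have d1 : (k : ℕ) < k' + 1 := by exact_mod_cast c1
  have d2 : (k' : ℕ) < k + 1 := by exact_mod_cast c2
  have : k = k' := Fin.ext (by omega)
  rw [this]

namespace DyadicRect

variable {d : ℕ}

lemma eq_of_mem {I J : DyadicRect d} {u : Fin d → ℝ} (hI : u ∈ I.toSet) (hJ : u ∈ J.toSet)
    (h : ∀ i, (I i).1 = (J i).1) : I = J :=
  funext fun i => DyadicInterval.eq_of_mem (hI i (Set.mem_univ i)) (hJ i (Set.mem_univ i)) (h i)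

/-- The rectangle `I` has measure `2 ^ (-I.level)`. -/
def level (I : DyadicRect d) : ℕ := ∑ i, (I i).1

lemma meas_eq (I : DyadicRect d) : I.meas = ((2 : ℝ) ^ I.level)⁻¹ := by
  unfold meas level
  rw [Finset.prod_inv_distrib, Finset.prod_pow_eq_pow_sum]

/-- The relative measure of `I ∩ J` in `I` is at most `2 ^ (-excess I J)`. -/
def excess (I J : DyadicRect d) : ℕ := ∑ i, ((J i).1 - (I i).1)

/-- In each direction the intersection is no longer than the shorter of the two sides; nesting is
not needed. -/
lemma volume_inter_le (I J : DyadicRect d) :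
    volume (I.toSet ∩ J.toSet) ≤ ENNReal.ofReal (I.meas * ((2 : ℝ) ^ excess I J)⁻¹) := by
  have hdiff : ∀ (K : DyadicRect d) (i : Fin d),
      volume (K i).toSet = ENNReal.ofReal (((2 : ℝ) ^ (K i).1)⁻¹) := by
    intro K i
    change volume (Set.Ico _ _) = _
    rw [Real.volume_Ico]
    congr 1
    field_simp
    ring
  unfold toSet meas excess
  rw [← Set.pi_inter_distrib, volume_pi_pi, ← Finset.prod_pow_eq_pow_sum,
    ← Finset.prod_inv_distrib, ← Finset.prod_mul_distrib,
    ENNReal.ofReal_prod_of_nonneg (fun i _ => by positivity)]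
  refine Finset.prod_le_prod' fun i _ => ?_
  rcases le_total (J i).1 (I i).1 with h | h
  · rw [Nat.sub_eq_zero_of_le h, pow_zero, inv_one, mul_one, ← hdiff]
    exact measure_mono Set.inter_subset_left
  · rw [← mul_inv, ← pow_add, Nat.add_sub_cancel' h, ← hdiff]
    exact measure_mono Set.inter_subset_right

/-- Among the rectangles that contain a point, few have both measure comparable to that of `I` and
not too small intersection with `I`. -/
lemma sum_pow_level_le {e : ℕ} {ρ : ℝ} (hρ0 : 0 < ρ) (hρ1 : ρ < 1) :
    ∃ C : ℝ, 0 < C ∧ ∀ (M : ℕ) (I : DyadicRect (e + 1)) (u : Fin (e + 1) → ℝ)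
      (D : Finset (DyadicRect (e + 1))),
      (∀ J ∈ D, u ∈ J.toSet ∧ J.level ≤ I.level ∧ excess I J ≤ M) →
      ∑ J ∈ D, ρ ^ (I.level - J.level) ≤ C * (2 * M + 1) ^ e := by
  classical
  have hsum : Summable fun k : ℕ => (2 * (k : ℝ) + 1) ^ e * ρ ^ k := by
    have h1 : Summable fun k : ℕ => (k : ℝ) ^ e * ρ ^ k :=
      summable_pow_mul_geometric_of_norm_lt_one e (by rwa [Real.norm_eq_abs, abs_of_pos hρ0])
    rw [← summable_nat_add_iff 1]
    refine ((((summable_nat_add_iff 1).mpr h1).mul_left (3 ^ e))).of_nonneg_of_le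
      (fun k => by positivity) fun k => ?_
    rw [← mul_assoc, ← mul_pow]
    gcongr
    push_cast
    have : (0 : ℝ) ≤ k := k.cast_nonneg
    linarith
  refine ⟨∑' k : ℕ, (2 * (k : ℝ) + 1) ^ e * ρ ^ k,
    hsum.tsum_pos (fun k => by positivity) 0 (by simp), ?_⟩
  intro M I u D hD
  -- If the levels differ by `k`, then `excess J I = k + excess I J ≤ k + M`, so each side exponent
  -- of `J` lies within `k + M` of that of `I`. The level recovers exponent `0` from the other `e`,
  -- and the point `u` recovers `J` from its exponents.
  have hfib : ∀ k : ℕ, (D.filter fun J => I.level - J.level = k).card ≤ (2 * (k + M) + 1) ^ e := by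
    intro k
    let P : Finset (Fin e → ℕ) := Fintype.piFinset fun i : Fin e =>
      Finset.Icc ((I i.succ).1 - (k + M)) ((I i.succ).1 + (k + M))
    have hP : P.card ≤ (2 * (k + M) + 1) ^ e := by
      rw [Fintype.card_piFinset]
      refine (Finset.prod_le_prod' (g := fun _ => 2 * (k + M) + 1) fun i _ => ?_).trans (by simp)
      rw [Nat.card_Icc]
      omega
    refine le_trans (Finset.card_le_card_of_injOn (t := P) (fun J i => (J i.succ).1) ?_ ?_) hP
    · intro J hJ
      obtain ⟨hJD, hk⟩ := Finset.mem_filter.mp hJ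
      obtain ⟨_, hle, hM⟩ := hD J hJD
      have hbal : I.level + excess I J = J.level + excess J I := by
        unfold level excess
        rw [← Finset.sum_add_distrib, ← Finset.sum_add_distrib]
        exact Finset.sum_congr rfl fun i _ => by omega
      refine Finset.mem_coe.mpr (Fintype.mem_piFinset.mpr fun i => Finset.mem_Icc.mpr ?_)
      have h1 : (J i.succ).1 - (I i.succ).1 ≤ excess I J :=
        Finset.single_le_sum (f := fun i => (J i).1 - (I i).1) (fun _ _ => Nat.zero_le _)
          (Finset.mem_univ i.succ)
      have h2 : (I i.succ).1 - (J i.succ).1 ≤ excess J I :=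
        Finset.single_le_sum (f := fun i => (I i).1 - (J i).1) (fun _ _ => Nat.zero_le _)
          (Finset.mem_univ i.succ)
      constructor <;> dsimp only <;> omega
    · intro J hJ J' hJ' hJJ'
      obtain ⟨hJD, hk⟩ := Finset.mem_filter.mp (Finset.mem_coe.mp hJ)
      obtain ⟨hJD', hk'⟩ := Finset.mem_filter.mp (Finset.mem_coe.mp hJ')
      obtain ⟨hu, hle, _⟩ := hD J hJD
      obtain ⟨hu', hle', _⟩ := hD J' hJD'
      have hlev : J.level = J'.level := by omega
      have hsucc : ∀ i : Fin e, (J i.succ).1 = (J' i.succ).1 := fun i => congrFun hJJ' i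
      refine eq_of_mem hu hu' (Fin.cases ?_ hsucc)
      unfold level at hlev
      rw [Fin.sum_univ_succ, Fin.sum_univ_succ, Finset.sum_congr rfl fun i _ => hsucc i] at hlev
      omega
  calc ∑ J ∈ D, ρ ^ (I.level - J.level)
      = ∑ k ∈ D.image (fun J => I.level - J.level),
          ((D.filter fun J => I.level - J.level = k).card : ℝ) * ρ ^ k := by
        rw [Finset.sum_comp (fun k => ρ ^ k) (fun J : DyadicRect (e + 1) => I.level - J.level)]
        simp
    _ ≤ ∑ k ∈ D.image (fun J => I.level - J.level),
          (2 * (M : ℝ) + 1) ^ e * ((2 * (k : ℝ) + 1) ^ e * ρ ^ k) := by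
        refine Finset.sum_le_sum fun k _ => ?_
        rw [← mul_assoc, ← mul_pow]
        refine mul_le_mul_of_nonneg_right ?_ (by positivity)
        have h1 : ((D.filter fun J => I.level - J.level = k).card : ℝ) ≤
            (2 * ((k : ℝ) + M) + 1) ^ e := by exact_mod_cast hfib k
        refine h1.trans (pow_le_pow_left₀ (by positivity) ?_ e)
        have h2 : (0 : ℝ) ≤ (k : ℝ) * M := by positivity
        nlinarith
    _ = (2 * (M : ℝ) + 1) ^ e *
          ∑ k ∈ D.image (fun J => I.level - J.level), (2 * (k : ℝ) + 1) ^ e * ρ ^ k := by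
        rw [Finset.mul_sum]
    _ ≤ (2 * (M : ℝ) + 1) ^ e * ∑' k : ℕ, (2 * (k : ℝ) + 1) ^ e * ρ ^ k := by
        refine mul_le_mul_of_nonneg_left ?_ (by positivity)
        exact hsum.sum_le_tsum _ fun k _ => by positivity
    _ = _ := mul_comm _ _

/-! ### Powers of sums of normalized indicators, pointwise and integrated. -/

lemma rpow_meas_eq {m : ℝ} (hm : 0 < m) (I : DyadicRect d) :
    (I.meas ^ (-1 / m)) ^ m = I.meas⁻¹ := by
  rw [← Real.rpow_mul I.meas_pos.le, div_mul_cancel₀ _ hm.ne', Real.rpow_neg_one]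

/-- Pointwise bound for `(∑_{I ∈ B} |I|^(-1/m) 1_I)^m`: up to exceptional pairs `I`, `J` with small
intersection, it is comparable to `∑_{I ∈ B} |I|⁻¹ 1_I`. -/
lemma sum_rpow_meas_rpow_le {e : ℕ} {m : ℝ} (hm : 1 < m) :
    ∃ C : ℝ, 0 < C ∧ ∀ (M N : ℕ) (u : Fin (e + 1) → ℝ) (B : Finset (DyadicRect (e + 1))),
      B.card ≤ N → (∀ J ∈ B, u ∈ J.toSet) →
      (∑ I ∈ B, I.meas ^ (-1 / m)) ^ m ≤
        ∑ I ∈ B, (m * (C * (2 * M + 1) ^ e) ^ (m - 1) * I.meas⁻¹ +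
          ∑ _J ∈ B.filter (fun J => M < excess I J), m * (N : ℝ) ^ (m - 1) * I.meas⁻¹) := by
  classical
  have hm0 : 0 < m := by linarith
  set ρ : ℝ := (2⁻¹ : ℝ) ^ (1 / m) with hρ
  have hρ0 : 0 < ρ := by positivity
  have hρ1 : ρ < 1 := Real.rpow_lt_one (by norm_num) (by norm_num) (by positivity)
  obtain ⟨C, hC, h⟩ := sum_pow_level_le (e := e) hρ0 hρ1
  refine ⟨C, hC, fun M N u B hN hu => ?_⟩
  have hpos : ∀ I : DyadicRect (e + 1), 0 < I.meas ^ (-1 / m) := fun I =>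
    Real.rpow_pos_of_pos I.meas_pos _
  refine (sum_rpow_le_mul_sum hm.le B fun I _ => (hpos I).le).trans ?_
  rw [Finset.mul_sum]
  refine Finset.sum_le_sum fun I hI => ?_
  set a := I.meas ^ (-1 / m) with ha
  have ham : a * a ^ (m - 1) = I.meas⁻¹ := by
    rw [← rpow_meas_eq hm0 I, ← ha]
    have := Real.rpow_add_one (hpos I).ne' (m - 1)
    rw [sub_add_cancel] at this
    rw [this, mul_comm]
  have hIpos := I.meas_pos
  set D := B.filter (fun J => J.meas ^ (-1 / m) ≤ a) with hD
  have hDnn : 0 ≤ ∑ J ∈ D, J.meas ^ (-1 / m) := Finset.sum_nonneg fun J _ => (hpos J).le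
  have conclude : ∀ X : ℝ, 0 ≤ X → ∑ J ∈ D, J.meas ^ (-1 / m) ≤ X * a →
      m * (a * (∑ J ∈ D, J.meas ^ (-1 / m)) ^ (m - 1)) ≤ m * X ^ (m - 1) * I.meas⁻¹ := by
    intro X hX hle
    have := Real.rpow_le_rpow hDnn hle (by linarith : 0 ≤ m - 1)
    rw [Real.mul_rpow hX (hpos I).le] at this
    calc m * (a * (∑ J ∈ D, J.meas ^ (-1 / m)) ^ (m - 1))
        ≤ m * (a * (X ^ (m - 1) * a ^ (m - 1))) := by have := hpos I; gcongr
      _ = m * X ^ (m - 1) * (a * a ^ (m - 1)) := by ring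
      _ = _ := by rw [ham]
  -- Without exceptional partners of `I`, the sum over the larger rectangles is a geometrically
  -- weighted count. Otherwise the trivial bound `N * a` is used, and its cost is charged to one
  -- exceptional partner `J₀`.
  rcases (B.filter (fun J => M < excess I J)).eq_empty_or_nonempty with hemp | ⟨J₀, hJ₀⟩
  · rw [hemp, Finset.sum_empty, add_zero]
    refine conclude _ (by positivity) ?_
    have hlev : ∀ J ∈ D, J.level ≤ I.level := by
      intro J hJ
      have h1 := (Finset.mem_filter.mp hJ).2
      rw [ha, Real.rpow_le_rpow_iff_of_neg J.meas_pos hIpos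
        (div_neg_of_neg_of_pos (by norm_num) hm0), meas_eq, meas_eq,
        inv_le_inv₀ (by positivity) (by positivity)] at h1
      exact (pow_le_pow_iff_right₀ (by norm_num : (1 : ℝ) < 2)).mp h1
    have h1 := h M I u D fun J hJ => by
      have hJB := (Finset.mem_filter.mp hJ).1
      refine ⟨hu J hJB, hlev J hJ, ?_⟩
      by_contra! hlt
      have : J ∈ B.filter (fun J => M < excess I J) := Finset.mem_filter.mpr ⟨hJB, hlt⟩
      rw [hemp] at this
      simp at this
    refine le_trans (le_of_eq ?_) (mul_le_mul_of_nonneg_right h1 (hpos I).le)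
    rw [Finset.sum_mul]
    refine Finset.sum_congr rfl fun J hJ => ?_
    have e1 : ∀ K : DyadicRect (e + 1), K.meas ^ (-1 / m) = ((2 : ℝ) ^ (1 / m)) ^ K.level := by
      intro K
      rw [meas_eq, ← Real.rpow_natCast, ← Real.rpow_natCast, ← Real.rpow_neg (by norm_num),
        ← Real.rpow_mul (by norm_num), ← Real.rpow_mul (by norm_num)]
      congr 1
      ring
    rw [ha, e1, e1, hρ, Real.inv_rpow (by norm_num)]
    have e2 : I.level = (I.level - J.level) + J.level := by have := hlev J hJ; omega
    conv_rhs => rw [e2, pow_add]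
    rw [Nat.add_sub_cancel, ← mul_assoc, ← mul_pow, inv_mul_cancel₀ (by positivity), one_pow,
      one_mul]
  · have h1 : m * (N : ℝ) ^ (m - 1) * I.meas⁻¹ ≤
        ∑ _J ∈ B.filter (fun J => M < excess I J), m * (N : ℝ) ^ (m - 1) * I.meas⁻¹ :=
      Finset.single_le_sum (f := fun _ => m * (N : ℝ) ^ (m - 1) * I.meas⁻¹)
        (fun _ _ => by positivity) hJ₀
    refine le_trans ?_ (le_add_of_nonneg_of_le (by positivity) h1)
    refine conclude _ (by positivity) ?_
    calc ∑ J ∈ D, J.meas ^ (-1 / m) ≤ ∑ _J ∈ D, a :=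
          Finset.sum_le_sum fun J hJ => (Finset.mem_filter.mp hJ).2
      _ = D.card * a := by simp
      _ ≤ N * a := by
          refine mul_le_mul_of_nonneg_right ?_ (hpos I).le
          exact_mod_cast (Finset.card_filter_le _ _).trans hN

lemma sum_normInd_eq {m : ℝ} (B : Finset (DyadicRect d)) (u : Fin d → ℝ)
    [DecidablePred fun I : DyadicRect d => u ∈ I.toSet] :
    ∑ I ∈ B, I.normInd m u =
      ENNReal.ofReal (∑ I ∈ B.filter (fun I => u ∈ I.toSet), I.meas ^ (-1 / m)) := by
  classical
  rw [ENNReal.ofReal_sum_of_nonneg fun I _ => Real.rpow_nonneg I.meas_pos.le _, Finset.sum_filter]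
  refine Finset.sum_congr rfl fun I _ => ?_
  unfold normInd
  rw [Set.indicator_apply]

lemma normInd_rpow {m : ℝ} (hm : 0 < m) {r : ℝ} (hr : 0 < r) (I : DyadicRect d) (u : Fin d → ℝ) :
    I.normInd m u ^ r = I.normInd (m / r) u := by
  unfold normInd
  by_cases hu : u ∈ I.toSet
  · rw [Set.indicator_of_mem hu, Set.indicator_of_mem hu,
      ENNReal.ofReal_rpow_of_nonneg (Real.rpow_nonneg I.meas_pos.le _) hr.le,
      ← Real.rpow_mul I.meas_pos.le]
    congr 2
    field_simp
  · rw [Set.indicator_of_notMem hu, Set.indicator_of_notMem hu, ENNReal.zero_rpow_of_pos hr]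

lemma lintegral_normInd_one (I : DyadicRect d) :
    ∫⁻ u in Set.Icc (0 : Fin d → ℝ) 1, I.normInd 1 u = 1 := by
  unfold normInd
  rw [lintegral_indicator_const I.measurableSet_toSet, Measure.restrict_apply I.measurableSet_toSet,
    Set.inter_eq_left.mpr I.toSet_subset, I.volume_toSet,
    ← ENNReal.ofReal_mul (Real.rpow_nonneg I.meas_pos.le _), div_one, Real.rpow_neg_one,
    inv_mul_cancel₀ I.meas_pos.ne', ENNReal.ofReal_one]

/-- For `m ≤ 1` the integral of `(∑_{I ∈ B} |I|^(-1/m) 1_I)^m` is at most `|B|`. -/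
theorem lintegral_sum_normInd_rpow_le_card {m : ℝ} (hm0 : 0 < m) (hm : m ≤ 1)
    (B : Finset (DyadicRect d)) :
    ∫⁻ u in Set.Icc (0 : Fin d → ℝ) 1, (∑ I ∈ B, I.normInd m u) ^ m ≤ B.card := by
  classical
  have hpt : ∀ u, (∑ I ∈ B, I.normInd m u) ^ m ≤ ∑ I ∈ B, I.normInd 1 u := by
    intro u
    induction B using Finset.induction_on with
    | empty => simp [hm0]
    | insert I B hI ih =>
      rw [Finset.sum_insert hI, Finset.sum_insert hI]
      refine (ENNReal.rpow_add_le_add_rpow _ _ hm0.le hm).trans (add_le_add ?_ ih)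
      rw [normInd_rpow hm0 hm0, div_self hm0.ne']
  refine (lintegral_mono hpt).trans ?_
  rw [lintegral_finsetSum _ fun I _ => I.measurable_normInd 1]
  simp [lintegral_normInd_one]

/-- For `m > 1` the integral of `(∑_{I ∈ B} |I|^(-1/m) 1_I)^m` over `[0,1]^(e+1)` is at most
`C |B| (1 + log N)^(e (m - 1))` if `|B| ≤ N`. -/
theorem lintegral_sum_normInd_rpow_le (e : ℕ) {m : ℝ} (hm : 1 < m) :
    ∃ C : ℝ, 0 < C ∧ ∀ (N : ℕ) (B : Finset (DyadicRect (e + 1))), 1 ≤ N → B.card ≤ N →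
      ∫⁻ u in Set.Icc (0 : Fin (e + 1) → ℝ) 1, (∑ I ∈ B, I.normInd m u) ^ m ≤
        ENNReal.ofReal (C * B.card * (1 + Real.log N) ^ (e * (m - 1))) := by
  classical
  have hm0 : 0 < m := by linarith
  obtain ⟨C, hC, h⟩ := sum_rpow_meas_rpow_le (e := e) hm
  set R : ℕ := ⌈m⌉₊ with hR
  refine ⟨m * ((C * (4 * R + 1) ^ e) ^ (m - 1) + 1), by positivity, fun N B hN1 hN => ?_⟩
  have hN0 : (0 : ℝ) < N := by exact_mod_cast hN1
  have hlog : 0 ≤ Real.log N := Real.log_natCast_nonneg N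
  -- Large enough that `2 ^ M ≥ N ^ m`, which makes exceptional intersections negligible, yet only
  -- of the order of `1 + log N`.
  set M : ℕ := R * (Nat.log 2 N + 1) with hM
  have hNM : (N : ℝ) ^ m ≤ 2 ^ M := by
    calc (N : ℝ) ^ m ≤ (N : ℝ) ^ (R : ℝ) :=
          Real.rpow_le_rpow_of_exponent_le (by exact_mod_cast hN1) (Nat.le_ceil m)
      _ = (N : ℝ) ^ R := Real.rpow_natCast _ _
      _ ≤ ((2 : ℝ) ^ (Nat.log 2 N + 1)) ^ R := by
          refine pow_le_pow_left₀ hN0.le ?_ R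
          exact_mod_cast (Nat.lt_pow_succ_log_self (by norm_num) N).le
      _ = 2 ^ M := by rw [← pow_mul, hM, mul_comm]
  have hM1 : 2 * (M : ℝ) + 1 ≤ (4 * R + 1) * (1 + Real.log N) := by
    have h1 : (Nat.log 2 N : ℝ) ≤ 2 * Real.log N := by
      have h2 := Real.natLog_le_logb N 2
      rw [Real.logb, Nat.cast_ofNat, le_div_iff₀ (Real.log_pos (by norm_num))] at h2
      have h3 := Real.log_two_gt_d9
      have h4 : (0 : ℝ) ≤ Nat.log 2 N := Nat.cast_nonneg _
      nlinarith
    rw [hM]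
    push_cast
    have h5 : (0 : ℝ) ≤ R := Nat.cast_nonneg _
    nlinarith
  set Z : ℝ := (C * (2 * M + 1) ^ e) ^ (m - 1) with hZ
  have hZ0 : 0 ≤ Z := by positivity
  set L : ℝ := (1 + Real.log N) ^ (e * (m - 1)) with hL
  have hL1 : 1 ≤ L := Real.one_le_rpow (by linarith) (mul_nonneg (by positivity) (by linarith))
  have hZle : Z ≤ (C * (4 * R + 1) ^ e) ^ (m - 1) * L := by
    rw [hL, Real.rpow_mul (by linarith), Real.rpow_natCast,
      ← Real.mul_rpow (by positivity) (by positivity), mul_assoc, ← mul_pow]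
    exact Real.rpow_le_rpow (by positivity)
      (mul_le_mul_of_nonneg_left (pow_le_pow_left₀ (by positivity) hM1 e) hC.le) (by linarith)
  have hpt : ∀ u, (∑ I ∈ B, I.normInd m u) ^ m ≤
      ∑ I ∈ B, (I.toSet.indicator (fun _ => ENNReal.ofReal (m * Z * I.meas⁻¹)) u +
        ∑ J ∈ B.filter (fun J => M < excess I J), (I.toSet ∩ J.toSet).indicator
          (fun _ => ENNReal.ofReal (m * (N : ℝ) ^ (m - 1) * I.meas⁻¹)) u) := by
    intro u
    rw [sum_normInd_eq, ENNReal.ofReal_rpow_of_nonneg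
      (Finset.sum_nonneg fun I _ => Real.rpow_nonneg I.meas_pos.le _) hm0.le]
    refine (ENNReal.ofReal_le_ofReal (h M N u _ ((Finset.card_filter_le _ _).trans hN)
      fun J hJ => (Finset.mem_filter.mp hJ).2)).trans ?_
    have hpos1 : ∀ I : DyadicRect (e + 1), 0 ≤ m * (N : ℝ) ^ (m - 1) * I.meas⁻¹ := fun I => by
      have := I.meas_pos; positivity
    have hpos2 : ∀ I : DyadicRect (e + 1), 0 ≤ m * Z * I.meas⁻¹ := fun I => by
      have := I.meas_pos; positivity
    rw [ENNReal.ofReal_sum_of_nonneg fun I _ =>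
      add_nonneg (hpos2 I) (Finset.sum_nonneg fun _ _ => hpos1 I), Finset.sum_filter]
    refine Finset.sum_le_sum fun I _ => ?_
    split_ifs with huI
    · rw [ENNReal.ofReal_add (hpos2 I) (Finset.sum_nonneg fun _ _ => hpos1 I),
        ENNReal.ofReal_sum_of_nonneg fun _ _ => hpos1 I, Set.indicator_of_mem huI]
      refine add_le_add le_rfl ?_
      rw [Finset.filter_comm, Finset.sum_filter]
      refine Finset.sum_le_sum fun J _ => ?_
      split_ifs with huJ
      · rw [Set.indicator_of_mem (Set.mem_inter huI huJ)]
      · exact zero_le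
    · exact zero_le
  have hterm : ∀ I ∈ B, ∫⁻ u in Set.Icc (0 : Fin (e + 1) → ℝ) 1,
      (I.toSet.indicator (fun _ => ENNReal.ofReal (m * Z * I.meas⁻¹)) u +
        ∑ J ∈ B.filter (fun J => M < excess I J), (I.toSet ∩ J.toSet).indicator
          (fun _ => ENNReal.ofReal (m * (N : ℝ) ^ (m - 1) * I.meas⁻¹)) u) ≤
      ENNReal.ofReal (m * Z + m) := by
    intro I _
    have hIpos := I.meas_pos
    rw [lintegral_add_left (measurable_const.indicator I.measurableSet_toSet),
      lintegral_finsetSum _ fun J _ => measurable_const.indicator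
        (I.measurableSet_toSet.inter J.measurableSet_toSet),
      ENNReal.ofReal_add (by positivity) hm0.le]
    refine add_le_add ?_ ?_
    · rw [lintegral_indicator_const I.measurableSet_toSet]
      refine (mul_le_mul_right (Measure.restrict_apply_le _ _) _).trans (le_of_eq ?_)
      rw [I.volume_toSet, ← ENNReal.ofReal_mul (by positivity), mul_assoc,
        inv_mul_cancel₀ hIpos.ne', mul_one]
    -- For fixed `I` there are at most `N` exceptional partners, each contributing at most `m *
    -- N^(m-1) * N^(-m)`; together at most `m`.
    · calc _ ≤ ∑ J ∈ B.filter (fun J => M < excess I J),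
            ENNReal.ofReal (m * (N : ℝ) ^ (-1 : ℝ)) := by
            refine Finset.sum_le_sum fun J hJ => ?_
            rw [lintegral_indicator_const (I.measurableSet_toSet.inter J.measurableSet_toSet)]
            refine (mul_le_mul_right ((Measure.restrict_apply_le _ _).trans
              (volume_inter_le I J)) _).trans ?_
            rw [← ENNReal.ofReal_mul (by positivity)]
            refine ENNReal.ofReal_le_ofReal ?_
            have h2 : ((2 : ℝ) ^ excess I J)⁻¹ ≤ ((N : ℝ) ^ m)⁻¹ := by
              refine inv_anti₀ (by positivity) (hNM.trans ?_)
              exact pow_le_pow_right₀ (by norm_num) (Finset.mem_filter.mp hJ).2.le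
            calc m * (N : ℝ) ^ (m - 1) * I.meas⁻¹ * (I.meas * ((2 : ℝ) ^ excess I J)⁻¹)
                = m * (N : ℝ) ^ (m - 1) * ((2 : ℝ) ^ excess I J)⁻¹ := by field_simp
              _ ≤ m * (N : ℝ) ^ (m - 1) * ((N : ℝ) ^ m)⁻¹ := by gcongr
              _ = m * (N : ℝ) ^ (-1 : ℝ) := by
                rw [mul_assoc, ← Real.rpow_neg hN0.le, ← Real.rpow_add hN0]; ring_nf
        _ = (B.filter (fun J => M < excess I J)).card • ENNReal.ofReal (m * (N : ℝ) ^ (-1 : ℝ)) :=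
            Finset.sum_const _
        _ ≤ N • ENNReal.ofReal (m * (N : ℝ) ^ (-1 : ℝ)) := by
            gcongr
            exact (Finset.card_filter_le _ _).trans hN
        _ = ENNReal.ofReal m := by
            rw [← ENNReal.ofReal_nsmul, nsmul_eq_mul, Real.rpow_neg_one]
            congr 1
            field_simp
  refine (lintegral_mono hpt).trans ?_
  rw [lintegral_finsetSum]
  swap
  · exact fun I _ => Measurable.add (measurable_const.indicator I.measurableSet_toSet)
      (Finset.measurable_fun_sum _ fun J _ => measurable_const.indicator
        (I.measurableSet_toSet.inter J.measurableSet_toSet))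
  refine (Finset.sum_le_sum hterm).trans ?_
  rw [Finset.sum_const, ← ENNReal.ofReal_nsmul, nsmul_eq_mul]
  refine ENNReal.ofReal_le_ofReal ?_
  have h3 : m * Z + m ≤ m * ((C * (4 * R + 1) ^ e) ^ (m - 1) + 1) * L := by
    nlinarith [mul_le_mul_of_nonneg_left hZle hm0.le]
  calc (B.card : ℝ) * (m * Z + m) ≤ B.card * (m * ((C * (4 * R + 1) ^ e) ^ (m - 1) + 1) * L) := by
        gcongr
    _ = _ := by ring

end DyadicRect

/-! ### Lattice structure of `f_{p,q}` -/

namespace Fpq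

variable {𝕜 : Type*} [RCLike 𝕜] {d : ℕ} {p q : ℝ} [hp : Fact (1 < p)] [hq : Fact (1 < q)]

@[ext] lemma ext {x y : Fpq 𝕜 d p q} (h : ∀ I, x.coord I = y.coord I) : x = y :=
  Subtype.ext (funext h)

@[simp] lemma coord_zero (I : DyadicRect d) : (0 : Fpq 𝕜 d p q).coord I = 0 := rfl

@[simp] lemma coord_add (x y : Fpq 𝕜 d p q) (I : DyadicRect d) :
    (x + y).coord I = x.coord I + y.coord I := rfl

@[simp] lemma coord_sub (x y : Fpq 𝕜 d p q) (I : DyadicRect d) :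
    (x - y).coord I = x.coord I - y.coord I := rfl

@[simp] lemma coord_smul (a : 𝕜) (x : Fpq 𝕜 d p q) (I : DyadicRect d) :
    (a • x).coord I = a * x.coord I := rfl

lemma coord_basis [DecidableEq (DyadicRect d)] (I J : DyadicRect d) :
    (basis 𝕜 d p q I).coord J = if J = I then 1 else 0 := by
  have : (basis 𝕜 d p q I).coord J = (Pi.single I (1 : 𝕜) : DyadicRect d → 𝕜) J := by
    unfold basis coord
    congr!
  rw [this, Pi.single_apply]

lemma fpqENorm_mono {x y : DyadicRect d → 𝕜} (h : ∀ I, ‖x I‖ ≤ ‖y I‖) :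
    fpqENorm p q x ≤ fpqENorm p q y := by
  have hp0 : 0 < p := one_pos.trans hp.out
  have hq0 : 0 < q := one_pos.trans hq.out
  unfold fpqENorm sqFun
  gcongr with u I
  exact enorm_le_iff_norm_le.mpr (h I)

lemma norm_mono {x y : Fpq 𝕜 d p q} (h : ∀ I, ‖x.coord I‖ ≤ ‖y.coord I‖) : ‖x‖ ≤ ‖y‖ :=
  ENNReal.toReal_mono (ne_of_lt y.2) (fpqENorm_mono h)

lemma norm_coord_le (x : Fpq 𝕜 d p q) (I : DyadicRect d) : ‖x.coord I‖ ≤ ‖x‖ := by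
  classical
  have h : ‖x.coord I • basis 𝕜 d p q I‖ ≤ ‖x‖ := by
    refine norm_mono fun J => ?_
    rw [coord_smul, coord_basis]
    split_ifs with h
    · rw [h, mul_one]
    · simp
  rwa [norm_smul, norm_basis, mul_one] at h

/-- The coordinate projection of `x` onto the coordinates in `S`. -/
def restr (x : Fpq 𝕜 d p q) (S : Set (DyadicRect d)) : Fpq 𝕜 d p q :=
  ⟨S.indicator x.coord, lt_of_le_of_lt
    (fpqENorm_mono fun I => norm_indicator_le_norm_self x.coord I) x.2⟩

lemma coord_restr (x : Fpq 𝕜 d p q) (S : Set (DyadicRect d)) (I : DyadicRect d) :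
    (restr x S).coord I = S.indicator x.coord I := rfl

lemma coord_restr_of_mem (x : Fpq 𝕜 d p q) {S : Set (DyadicRect d)} {I : DyadicRect d}
    (h : I ∈ S) : (restr x S).coord I = x.coord I := Set.indicator_of_mem h _

lemma coord_restr_of_notMem (x : Fpq 𝕜 d p q) {S : Set (DyadicRect d)} {I : DyadicRect d}
    (h : I ∉ S) : (restr x S).coord I = 0 := Set.indicator_of_notMem h _

lemma norm_restr_mono (x : Fpq 𝕜 d p q) : Monotone fun S => ‖restr x S‖ := by
  intro S T hST
  refine norm_mono fun I => ?_
  by_cases h : I ∈ S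
  · rw [coord_restr_of_mem x h, coord_restr_of_mem x (hST h)]
  · rw [coord_restr_of_notMem x h, norm_zero]; exact norm_nonneg _

lemma norm_restr_le (x : Fpq 𝕜 d p q) (S : Set (DyadicRect d)) : ‖restr x S‖ ≤ ‖x‖ :=
  norm_mono fun I => norm_indicator_le_norm_self x.coord I

lemma norm_restr_union_le (x : Fpq 𝕜 d p q) (S T : Set (DyadicRect d)) :
    ‖restr x (S ∪ T)‖ ≤ ‖restr x S‖ + ‖restr x T‖ := by
  have h : restr x (S ∪ T) = restr x S + restr x (T \ S) := by
    ext I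
    rw [coord_add]
    simp only [coord_restr]
    by_cases h1 : I ∈ S <;> by_cases h2 : I ∈ T <;> simp [h1, h2]
  rw [h]
  exact (norm_add_le _ _).trans
    (add_le_add_right (norm_restr_mono x Set.sdiff_subset) _)

lemma restr_finset_eq_sum (x : Fpq 𝕜 d p q) (B : Finset (DyadicRect d)) :
    restr x B = ∑ I ∈ B, x.coord I • basis 𝕜 d p q I := by
  classical
  induction B using Finset.induction_on with
  | empty => ext I; simp [coord_restr]
  | insert I B hI ih =>
    rw [Finset.sum_insert hI, ← ih]
    ext J
    rw [coord_add, coord_smul, coord_basis]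
    simp only [coord_restr, Set.indicator_apply, Finset.mem_coe, Finset.mem_insert]
    by_cases h1 : J = I
    · subst h1; simp [hI]
    · simp [h1]

/-- The function `(S_q x)^q`. -/
def qSum (p q : ℝ) (x : DyadicRect d → 𝕜) (u : Fin d → ℝ) : ℝ≥0∞ :=
  ∑' I : DyadicRect d, (‖x I‖ₑ * I.normInd p u) ^ q

lemma measurable_qSum (p q : ℝ) (x : DyadicRect d → 𝕜) : Measurable (qSum p q x) :=
  Measurable.tsum fun I => ((I.measurable_normInd p).const_mul _).pow_const _

lemma ofReal_norm_rpow (x : Fpq 𝕜 d p q) :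
    ENNReal.ofReal (‖x‖ ^ p) =
      ∫⁻ u in Set.Icc (0 : Fin d → ℝ) 1, qSum p q x.coord u ^ (p / q) := by
  have hp0 : 0 < p := one_pos.trans hp.out
  rw [← ENNReal.ofReal_rpow_of_nonneg (norm_nonneg x) hp0.le, norm_def,
    ENNReal.ofReal_toReal (show fpqENorm p q x.coord ≠ ∞ from ne_of_lt x.2)]
  unfold fpqENorm sqFun qSum
  rw [← ENNReal.rpow_mul, one_div_mul_cancel hp0.ne', ENNReal.rpow_one]
  refine lintegral_congr fun u => ?_
  rw [← ENNReal.rpow_mul, one_div_mul_eq_div]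

lemma qSum_eq_add (x : Fpq 𝕜 d p q) (I : DyadicRect d) (u : Fin d → ℝ) :
    qSum p q x.coord u =
      qSum p q (restr x {I}ᶜ).coord u + (‖x.coord I‖ₑ * I.normInd p u) ^ q := by
  classical
  have hq0 : 0 < q := one_pos.trans hq.out
  unfold qSum
  rw [ENNReal.tsum_eq_add_tsum_ite I, add_comm]
  congr 1
  refine tsum_congr fun J => ?_
  by_cases h : J = I
  · simp [h, coord_restr, hq0]
  · simp [h, coord_restr]

lemma restr_compl_congr {x w : Fpq 𝕜 d p q} {I : DyadicRect d}
    (h : ∀ J, J ≠ I → w.coord J = x.coord J) : restr w {I}ᶜ = restr x {I}ᶜ := by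
  ext J
  by_cases hJ : J = I
  · simp [hJ, coord_restr]
  · simp [coord_restr, h J hJ, hJ]

/-- The increase of the norm when the coordinate `x_I` is enlarged by the factor `K` is controlled
by its decrease when `x_I` is removed. -/
lemma norm_rpow_add_le (p q : ℝ) [hp : Fact (1 < p)] [hq : Fact (1 < q)] {K : ℝ} (hK : 1 < K) :
    ∃ C : ℝ, 0 < C ∧ ∀ (𝕜 : Type) [RCLike 𝕜] (d : ℕ) (x w : Fpq 𝕜 d p q) (I : DyadicRect d),
      (∀ J, J ≠ I → w.coord J = x.coord J) → ‖w.coord I‖ ≤ K * ‖x.coord I‖ →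
      ‖w‖ ^ p + C * ‖restr x {I}ᶜ‖ ^ p ≤ (1 + C) * ‖x‖ ^ p := by
  have hp0 : 0 < p := one_pos.trans hp.out
  have hq0 : 0 < q := one_pos.trans hq.out
  -- Pointwise, `(S_q x)^p` is `(r + b)^(p/q)`, where `b` is the term of `I` and `r` the sum of the
  -- others; enlarging `x_I` by `K` multiplies `b` by `K^q`. Integration preserves the inequality.
  obtain ⟨C, hC, h⟩ := ENNReal.add_mul_rpow_add_mul_rpow_le (m := p / q) (K := K ^ q)
    (by positivity) (Real.one_lt_rpow hK hq0)
  refine ⟨C, hC, fun 𝕜 _ d x w I hoff hI => ?_⟩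
  rw [← ENNReal.ofReal_le_ofReal_iff (by positivity),
    ENNReal.ofReal_add (by positivity) (by positivity), ENNReal.ofReal_mul hC.le,
    ENNReal.ofReal_mul (by positivity), ofReal_norm_rpow, ofReal_norm_rpow, ofReal_norm_rpow,
    ← lintegral_const_mul _ ((measurable_qSum _ _ _).pow_const _),
    ← lintegral_const_mul _ ((measurable_qSum _ _ _).pow_const _),
    ← lintegral_add_left ((measurable_qSum _ _ _).pow_const _)]
  refine lintegral_mono fun u => ?_
  rw [qSum_eq_add w I, qSum_eq_add x I, restr_compl_congr hoff]
  refine le_trans ?_ (h _ _)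
  gcongr
  rw [← ENNReal.ofReal_rpow_of_nonneg (by linarith) hq0.le,
    ← ENNReal.mul_rpow_of_nonneg _ _ hq0.le, ← mul_assoc]
  gcongr
  rw [← ofReal_norm, ← ofReal_norm, ← ENNReal.ofReal_mul (by linarith)]
  exact ENNReal.ofReal_le_ofReal hI

/-- An upper `min p q`-estimate for a vector and a coordinate. -/
lemma norm_rpow_min_le (x : Fpq 𝕜 d p q) (I : DyadicRect d) :
    ‖x‖ ^ min p q ≤ ‖restr x {I}ᶜ‖ ^ min p q + ‖x.coord I‖ ^ min p q := by
  have hp0 : 0 < p := one_pos.trans hp.out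
  have hq0 : 0 < q := one_pos.trans hq.out
  have hb : ∫⁻ u in Set.Icc (0 : Fin d → ℝ) 1,
      ((‖x.coord I‖ₑ * I.normInd p u) ^ q) ^ (p / q) = ENNReal.ofReal (‖x.coord I‖ ^ p) := by
    have : ∀ u, ((‖x.coord I‖ₑ * I.normInd p u) ^ q) ^ (p / q) =
        ‖x.coord I‖ₑ ^ p * I.normInd 1 u := by
      intro u
      rw [← ENNReal.rpow_mul, mul_div_cancel₀ _ hq0.ne', ENNReal.mul_rpow_of_nonneg _ _ hp0.le,
        DyadicRect.normInd_rpow hp0 hp0, div_self hp0.ne']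
    simp_rw [this]
    rw [lintegral_const_mul _ (I.measurable_normInd 1), DyadicRect.lintegral_normInd_one, mul_one,
      ← ofReal_norm, ENNReal.ofReal_rpow_of_nonneg (norm_nonneg _) hp0.le]
  have hmeas : Measurable fun u => (‖x.coord I‖ₑ * I.normInd p u) ^ q :=
    ((I.measurable_normInd p).const_mul _).pow_const _
  -- For `p ≤ q` the power `p / q` is subadditive pointwise; for `q ≤ p` the estimate is the
  -- triangle inequality in `L^(p/q)`.
  rcases le_total p q with h | h
  · rw [min_eq_left h, ← ENNReal.ofReal_le_ofReal_iff (by positivity),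
      ENNReal.ofReal_add (by positivity) (by positivity), ofReal_norm_rpow, ofReal_norm_rpow, ← hb,
      ← lintegral_add_left ((measurable_qSum _ _ _).pow_const _)]
    refine lintegral_mono fun u => ?_
    rw [qSum_eq_add x I]
    exact ENNReal.rpow_add_le_add_rpow _ _ (by positivity) (by rwa [div_le_one hq0])
  · have key := ENNReal.lintegral_Lp_add_le (μ := volume.restrict (Set.Icc (0 : Fin d → ℝ) 1))
      (p := p / q) (measurable_qSum p q (restr x {I}ᶜ).coord).aemeasurable hmeas.aemeasurable
      (by rwa [one_le_div hq0])
    have e : ∀ t : ℝ, 0 ≤ t → ENNReal.ofReal (t ^ p) ^ (1 / (p / q)) = ENNReal.ofReal (t ^ q) := by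
      intro t ht
      rw [ENNReal.ofReal_rpow_of_nonneg (by positivity) (by positivity), ← Real.rpow_mul ht]
      congr 2
      field_simp
    simp only [Pi.add_apply, ← qSum_eq_add x I] at key
    rw [hb, ← ofReal_norm_rpow, ← ofReal_norm_rpow, e _ (norm_nonneg _), e _ (norm_nonneg _),
      e _ (norm_nonneg _), ← ENNReal.ofReal_add (by positivity) (by positivity),
      ENNReal.ofReal_le_ofReal_iff (by positivity)] at key
    rwa [min_eq_right h]

/-- The norm is strictly monotone in each coordinate. -/
lemma coord_eq_zero_of_norm_le {𝕜 : Type} [RCLike 𝕜] {x : Fpq 𝕜 d p q} {I : DyadicRect d}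
    (h : ‖x‖ ≤ ‖restr x {I}ᶜ‖) : x.coord I = 0 := by
  classical
  by_contra hI
  have hp0 : 0 < p := one_pos.trans hp.out
  have hpos : 0 < ‖x.coord I‖ := norm_pos_iff.mpr hI
  -- If deleting `x_I` did not lower the norm, enlarging it by any factor would not raise it. This
  -- `K` makes the single coordinate exceed `‖x‖`.
  set K : ℝ := ‖x‖ / ‖x.coord I‖ + 2 with hK
  have hK1 : 1 < K := by have : 0 ≤ ‖x‖ / ‖x.coord I‖ := by positivity
                         linarith
  obtain ⟨C, hC, hle⟩ := norm_rpow_add_le p q hK1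
  set w : Fpq 𝕜 d p q := x + (((K - 1 : ℝ) : 𝕜) * x.coord I) • basis 𝕜 d p q I
  have hwI : w.coord I = ((K : ℝ) : 𝕜) * x.coord I := by
    simp only [w, coord_add, coord_smul, coord_basis, if_true]
    push_cast
    ring
  have hnw : ‖w.coord I‖ = K * ‖x.coord I‖ := by
    rw [hwI, norm_mul, RCLike.norm_ofReal, abs_of_pos (by linarith)]
  have h1 := hle 𝕜 d x w I (fun J hJ => by simp [w, coord_basis, hJ]) hnw.le
  have h2 : ‖x‖ ^ p ≤ ‖restr x {I}ᶜ‖ ^ p := Real.rpow_le_rpow (norm_nonneg _) h hp0.le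
  have h3 : ‖w‖ ^ p ≤ ‖x‖ ^ p := by nlinarith
  rw [Real.rpow_le_rpow_iff (norm_nonneg _) (norm_nonneg _) hp0] at h3
  have h4 := norm_coord_le w I
  have h5 : K * ‖x.coord I‖ = ‖x‖ + 2 * ‖x.coord I‖ := by rw [hK]; field_simp
  linarith

/-- Duality with the indicator of a finite set. -/
lemma sum_norm_coord_le (x : Fpq 𝕜 d p q) (B : Finset (DyadicRect d)) {X : ℝ} (hX : 0 ≤ X)
    (h : ∫⁻ u in Set.Icc (0 : Fin d → ℝ) 1, (∑ I ∈ B, I.normInd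
        (Real.conjExponent p / Real.conjExponent q) u) ^
          (Real.conjExponent p / Real.conjExponent q) ≤ ENNReal.ofReal X) :
    ∑ I ∈ B, ‖x.coord I‖ ≤ X ^ (1 / Real.conjExponent p) * ‖x‖ := by
  have hpp := Real.HolderConjugate.conjExponent hp.out
  have hqq := Real.HolderConjugate.conjExponent hq.out
  set p' := Real.conjExponent p
  set q' := Real.conjExponent q
  have hp0 : 0 < p := one_pos.trans hp.out
  have hq0 : 0 < q := one_pos.trans hq.out
  have hp'0 : 0 < p' := hpp.symm.pos
  have hq'0 : 0 < q' := hqq.symm.pos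
  have hprod : ∀ (I : DyadicRect d) u, I.normInd p u * I.normInd p' u = I.normInd 1 u := by
    intro I u
    unfold DyadicRect.normInd
    by_cases hu : u ∈ I.toSet
    · rw [Set.indicator_of_mem hu, Set.indicator_of_mem hu, Set.indicator_of_mem hu,
        ← ENNReal.ofReal_mul (Real.rpow_nonneg I.meas_pos.le _), ← Real.rpow_add I.meas_pos]
      congr 2
      have := hpp.inv_add_inv_eq_one
      rw [neg_div, neg_div, neg_div, one_div, one_div, div_one]
      linarith
    · simp [Set.indicator_of_notMem hu]
  have hpow : ∀ (I : DyadicRect d) u, I.normInd p' u ^ q' = I.normInd (p' / q') u := fun I u =>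
    DyadicRect.normInd_rpow hp'0 hq'0 I u
  -- Writing each modulus as an integral of a product prepares two applications of Hölder's
  -- inequality: to the sum with `q, q'`, and to the integral with `p, p'`.
  have hsum : ∑ I ∈ B, ‖x.coord I‖ₑ = ∫⁻ u in Set.Icc (0 : Fin d → ℝ) 1,
      ∑ I ∈ B, (‖x.coord I‖ₑ * I.normInd p u) * I.normInd p' u := by
    rw [lintegral_finsetSum _ fun I _ =>
      ((I.measurable_normInd p).const_mul _).mul (I.measurable_normInd p')]
    refine Finset.sum_congr rfl fun I _ => ?_
    simp_rw [mul_assoc, hprod]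
    rw [lintegral_const_mul _ (I.measurable_normInd 1), DyadicRect.lintegral_normInd_one, mul_one]
  have hle : ∑ I ∈ B, ‖x.coord I‖ₑ ≤ fpqENorm p q x.coord * ENNReal.ofReal X ^ (1 / p') := by
    rw [hsum]
    calc _ ≤ ∫⁻ u in Set.Icc (0 : Fin d → ℝ) 1, ((fun u => sqFun p q x.coord u) *
          (fun u => (∑ I ∈ B, I.normInd (p' / q') u) ^ (1 / q'))) u := by
          refine lintegral_mono fun u => ?_
          refine (ENNReal.inner_le_Lp_mul_Lq B _ _ hqq).trans ?_
          simp_rw [hpow]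
          refine mul_le_mul_left ?_ _
          exact ENNReal.rpow_le_rpow (ENNReal.sum_le_tsum B) (by positivity)
      _ ≤ _ := ENNReal.lintegral_mul_le_Lp_mul_Lq _ hpp (measurable_sqFun p q _).aemeasurable
          ((Finset.measurable_fun_sum _ fun I _ => I.measurable_normInd _).pow_const _).aemeasurable
      _ ≤ _ := by
          refine mul_le_mul_right ?_ _
          refine ENNReal.rpow_le_rpow (le_trans (le_of_eq ?_) h) (by positivity)
          refine lintegral_congr fun u => ?_
          rw [← ENNReal.rpow_mul]
          congr 1
          ring
  have hfin : fpqENorm p q x.coord ≠ ∞ := ne_of_lt x.2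
  rw [← ENNReal.ofReal_toReal hfin, ← norm_def, ENNReal.ofReal_rpow_of_nonneg hX (by positivity),
    ← ENNReal.ofReal_mul (norm_nonneg _)] at hle
  simp_rw [← ofReal_norm] at hle
  rw [← ENNReal.ofReal_sum_of_nonneg fun _ _ => norm_nonneg _,
    ENNReal.ofReal_le_ofReal_iff (by positivity)] at hle
  rwa [mul_comm]

/-! ### Norming functionals and the greedy step -/

lemma rpow_add_mul_le_add_rpow {X t r : ℝ} (hX : 0 < X) (ht : 0 ≤ t) (hr : 1 ≤ r) :
    X ^ r + r * t * X ^ (r - 1) ≤ (X + t) ^ r := by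
  have h := one_add_mul_self_le_rpow_one_add (s := t / X)
    (le_trans (by norm_num) (div_nonneg ht hX.le)) hr
  have h2 := mul_le_mul_of_nonneg_right h (Real.rpow_nonneg hX.le r)
  rw [← Real.mul_rpow (by positivity) hX.le] at h2
  have e1 : (1 + t / X) * X = X + t := by field_simp
  have e2 : (1 + r * (t / X)) * X ^ r = X ^ r + r * t * X ^ (r - 1) := by
    rw [Real.rpow_sub_one hX.ne']
    field_simp
  rwa [e1, e2] at h2

/-- A norming functional gives a lower bound for the norm along a coordinate direction. -/
lemma exists_unit_norm_add_mul_le {𝕜 E : Type*} [RCLike 𝕜] [NormedAddCommGroup E]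
    [NormedSpace 𝕜 E] {F : StrongDual 𝕜 E} {x : E} (hF : IsNorming F x) (e : E) :
    ∃ v : 𝕜, ‖v‖ = 1 ∧ ∀ t : ℝ, 0 ≤ t → ‖x‖ + t * ‖F e‖ ≤ ‖x + ((t : 𝕜) * v) • e‖ := by
  obtain ⟨v, hv, hve⟩ := RCLike.exists_norm_eq_mul_self (F e)
  refine ⟨v, hv, fun t ht => ?_⟩
  have h1 : F (x + ((t : 𝕜) * v) • e) = ((‖x‖ + t * ‖F e‖ : ℝ) : 𝕜) := by
    rw [map_add, map_smul, hF.2, smul_eq_mul, mul_assoc, ← hve]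
    push_cast
    ring
  have h2 := F.le_opNorm (x + ((t : 𝕜) * v) • e)
  rwa [h1, hF.1, one_mul, RCLike.norm_ofReal, abs_of_nonneg (by positivity)] at h2

/-- Removing the coordinate `x_I` decreases the norm in terms of the value at `e_I` of a norming
functional of `x`. -/
theorem norm_restr_compl_rpow_le (p q : ℝ) [hp : Fact (1 < p)] [hq : Fact (1 < q)] :
    ∃ κ : ℝ, 0 < κ ∧ ∀ (𝕜 : Type) [RCLike 𝕜] (d : ℕ) (x : Fpq 𝕜 d p q)
      (F : StrongDual 𝕜 (Fpq 𝕜 d p q)), IsNorming F x → ∀ I : DyadicRect d,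
      ‖restr x {I}ᶜ‖ ^ p ≤
        (1 - κ * ‖F (basis 𝕜 d p q I)‖ ^ Real.conjExponent (min p q)) * ‖x‖ ^ p := by
  classical
  have hp0 : 0 < p := one_pos.trans hp.out
  obtain ⟨C, hC, hle⟩ := norm_rpow_add_le p q (K := 2) (by norm_num)
  set s := min p q with hs
  have hs1 : 1 < s := lt_min hp.out hq.out
  have hs0 : 0 < s - 1 := by linarith
  -- Chosen so that, for the `l` below, `(2 l)^s` is exactly half of the first-order gain `s l Φ
  -- ‖x‖^(s-1)`.
  set c : ℝ := (s / 2 ^ (s + 1)) ^ (1 / (s - 1)) with hc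
  have hc0 : 0 < c := by positivity
  refine ⟨p / C * c, by positivity, fun 𝕜 _ d x F hF I => ?_⟩
  set Φ := ‖F (basis 𝕜 d p q I)‖ with hΦ
  have hconj : Real.conjExponent s = 1 / (s - 1) + 1 := by
    rw [Real.conjExponent]; field_simp; ring
  have hmono : ‖restr x {I}ᶜ‖ ≤ ‖x‖ := norm_restr_le x _
  rcases (norm_nonneg (F (basis 𝕜 d p q I))).eq_or_lt with h0 | hΦ0
  · rw [hΦ, ← h0, Real.zero_rpow (by rw [hconj]; positivity), mul_zero, sub_zero, one_mul]
    exact Real.rpow_le_rpow (norm_nonneg _) hmono hp0.le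
  rcases (norm_nonneg x).eq_or_lt with h0 | hx
  · rw [← h0] at hmono
    rw [← h0, le_antisymm hmono (norm_nonneg _), Real.zero_rpow hp0.ne', mul_zero]
  obtain ⟨v, hv, hlow⟩ := exists_unit_norm_add_mul_le hF (basis 𝕜 d p q I)
  rw [← hΦ] at hlow hΦ0
  have hcoord : ∀ t : ℝ, 0 ≤ t →
      ‖(x + ((t : 𝕜) * v) • basis 𝕜 d p q I).coord I‖ ≤ ‖x.coord I‖ + t := by
    intro t ht
    rw [coord_add, coord_smul, coord_basis, if_pos rfl, mul_one]
    refine (norm_add_le _ _).trans (add_le_add_right (le_of_eq ?_) _)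
    rw [norm_mul, hv, mul_one, RCLike.norm_ofReal, abs_of_nonneg ht]
  have hoff : ∀ (t : ℝ) (J : DyadicRect d), J ≠ I →
      (x + ((t : 𝕜) * v) • basis 𝕜 d p q I).coord J = x.coord J := by
    intro t J hJ
    simp [coord_basis, hJ]
  set l : ℝ := ‖x‖ * (c * Φ ^ (1 / (s - 1))) with hl
  have hl0 : 0 < l := by positivity
  have hlpow : 2 ^ s * l ^ (s - 1) = s * Φ / 2 * ‖x‖ ^ (s - 1) := by
    rw [hl, hc, ← Real.mul_rpow (by positivity) hΦ0.le, Real.mul_rpow hx.le (by positivity),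
      ← Real.rpow_mul (by positivity), one_div_mul_cancel hs0.ne', Real.rpow_one,
      Real.rpow_add_one (by norm_num : (2 : ℝ) ≠ 0)]
    field_simp
  -- A smaller coordinate would have modulus at most `2 l` after a move by `l`. The upper
  -- `s`-estimate then allows `‖·‖^s` to grow by at most `(2 l)^s`, less than the functional
  -- enforces.
  have hla : l ≤ ‖x.coord I‖ := by
    by_contra! hlt
    have h1 := rpow_add_mul_le_add_rpow hx (mul_nonneg hl0.le hΦ0.le) hs1.le
    have h2 := Real.rpow_le_rpow (by positivity) (hlow l hl0.le) (by linarith : 0 ≤ s)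
    have h3 := norm_rpow_min_le (x + ((l : 𝕜) * v) • basis 𝕜 d p q I) I
    rw [restr_compl_congr (hoff l), ← hs] at h3
    have h4 : ‖restr x {I}ᶜ‖ ^ s ≤ ‖x‖ ^ s := Real.rpow_le_rpow (norm_nonneg _) hmono (by linarith)
    have h5 : ‖(x + ((l : 𝕜) * v) • basis 𝕜 d p q I).coord I‖ ^ s ≤ (2 * l) ^ s :=
      Real.rpow_le_rpow (norm_nonneg _) ((hcoord l hl0.le).trans (by linarith)) (by linarith)
    have h6 : (2 * l) ^ s = s * Φ / 2 * ‖x‖ ^ (s - 1) * l := by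
      rw [Real.mul_rpow (by norm_num) hl0.le, ← hlpow, mul_assoc, ← Real.rpow_add_one hl0.ne',
        sub_add_cancel]
    have h7 : 0 < s * Φ * ‖x‖ ^ (s - 1) * l := by positivity
    nlinarith
  set a := ‖x.coord I‖ with ha
  have ha0 : 0 ≤ a := norm_nonneg _
  -- A move by `|x_I|` at most doubles the coordinate, so the gain enforced by `F` becomes a loss
  -- upon deletion. The exponent of `Φ` is `1/(s-1) + 1 = s'`.
  have h1 := hle 𝕜 d x _ I (hoff a) ((hcoord a ha0).trans (by linarith))
  have h2 := Real.rpow_le_rpow (by positivity) (hlow a ha0) hp0.le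
  have h3 := rpow_add_mul_le_add_rpow hx (mul_nonneg ha0 hΦ0.le) hp.out.le
  have h4 : p * (a * Φ) * ‖x‖ ^ (p - 1) ≥ p * c * Φ ^ Real.conjExponent s * ‖x‖ ^ p := by
    calc p * (a * Φ) * ‖x‖ ^ (p - 1) ≥ p * (l * Φ) * ‖x‖ ^ (p - 1) := by gcongr
      _ = p * c * (Φ ^ (1 / (s - 1)) * Φ) * (‖x‖ ^ (p - 1) * ‖x‖) := by rw [hl]; ring
      _ = _ := by
        rw [← Real.rpow_add_one hΦ0.ne', ← Real.rpow_add_one hx.ne', sub_add_cancel, ← hconj]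
  have h5 : C * ‖restr x {I}ᶜ‖ ^ p ≤
      C * ((1 - p / C * c * Φ ^ Real.conjExponent s) * ‖x‖ ^ p) := by
    have e : C * ((1 - p / C * c * Φ ^ Real.conjExponent s) * ‖x‖ ^ p) =
        C * ‖x‖ ^ p - p * c * Φ ^ Real.conjExponent s * ‖x‖ ^ p := by
      field_simp
    rw [e]
    linarith
  exact le_of_mul_le_mul_left h5 hC

/-! ### Duality constants -/

/-- The factor `(1 + log N)^{p' h(p,q;d)} N^{α(p,q) - 1}`. -/
def growth (p q : ℝ) (d N : ℕ) : ℝ :=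
  (1 + Real.log N) ^ (Real.conjExponent p * hExp p q d) * (N : ℝ) ^ (alphaExp p q - 1)

lemma conjExponent_anti {p q : ℝ} (hp : 1 < p) (h : p ≤ q) :
    Real.conjExponent q ≤ Real.conjExponent p := by
  rw [Real.conjExponent, Real.conjExponent, div_le_div_iff₀ (by linarith) (by linarith)]
  linarith

lemma one_le_alphaExp {p q : ℝ} (hp : 1 < p) (hq : 1 < q) : 1 ≤ alphaExp p q := by
  unfold alphaExp
  split_ifs with h
  · exact le_rfl
  · rw [one_le_div (Real.HolderConjugate.conjExponent hp).symm.pos]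
    exact conjExponent_anti hq (le_of_not_ge h)

/-- This keeps the decay rates at most `1` and lets `growth` absorb the rounding in the number of
steps. -/
lemma one_le_growth {p q : ℝ} (hp : 1 < p) (hq : 1 < q) {d N : ℕ} (hd : 1 ≤ d) (hN : 1 ≤ N) :
    1 ≤ growth p q d N := by
  have h1 : (1 : ℝ) ≤ d := by exact_mod_cast hd
  have h2 : (1 : ℝ) ≤ N := by exact_mod_cast hN
  refine one_le_mul_of_one_le_of_one_le ?_ ?_
  · refine Real.one_le_rpow (by linarith [Real.log_nonneg h2]) (mul_nonneg ?_ ?_)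
    · exact (Real.HolderConjugate.conjExponent hp).symm.nonneg
    · exact mul_nonneg (by linarith) (le_max_right _ _)
  · exact Real.one_le_rpow h2 (by linarith [one_le_alphaExp hp hq])

/-- The `ℓ¹` norm of `N` coordinates, with the sharp dependence on `N`. -/
theorem sum_norm_coord_le_growth (p q : ℝ) [hp : Fact (1 < p)] [hq : Fact (1 < q)] {d : ℕ}
    (hd : 1 ≤ d) : ∃ C : ℝ, 0 < C ∧ ∀ (𝕜 : Type) [RCLike 𝕜] (x : Fpq 𝕜 d p q) (N : ℕ)
      (B : Finset (DyadicRect d)), 1 ≤ N → B.card ≤ N → ∃ K : ℝ, 0 ≤ K ∧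
      ∑ I ∈ B, ‖x.coord I‖ ≤ K * ‖x‖ ∧
      K ^ Real.conjExponent (min p q) ≤ C * B.card * growth p q d N := by
  have hp0 : 0 < p := one_pos.trans hp.out
  have hq0 : 0 < q := one_pos.trans hq.out
  have hpp := Real.HolderConjugate.conjExponent hp.out
  have hqq := Real.HolderConjugate.conjExponent hq.out
  have hp'0 := hpp.symm.pos
  have hq'0 := hqq.symm.pos
  -- For `q ≤ p` one has `K = |B|^(1/p')` and `s' = q'`, so `K^s' = |B|^α`. For `p < q` one has `s'
  -- = p'`, and `K^s'` is the integral bound itself, with logarithmic exponent `(d-1)(p'/q' - 1) =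
  -- p' h`.
  rcases le_or_gt q p with h | h
  · refine ⟨1, one_pos, fun 𝕜 _ x N B hN hB => ⟨(B.card : ℝ) ^ (1 / Real.conjExponent p),
      by positivity, sum_norm_coord_le x B (by positivity) ?_, ?_⟩⟩
    · rw [ENNReal.ofReal_natCast]
      exact DyadicRect.lintegral_sum_normInd_rpow_le_card (by positivity)
        ((div_le_one hq'0).mpr (conjExponent_anti hq.out h)) B
    · have hα : alphaExp p q = Real.conjExponent q / Real.conjExponent p := by
        unfold alphaExp
        split_ifs with h'
        · rw [le_antisymm h h', div_self hp'0.ne']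
        · rfl
      have hh : hExp p q d = 0 := by
        have : 1 / p - 1 / q ≤ 0 := sub_nonpos.mpr (one_div_le_one_div_of_le hq0 h)
        rw [hExp, max_eq_right this, mul_zero]
      rw [min_eq_right h, growth, hh, mul_zero, Real.rpow_zero, one_mul, one_mul,
        ← Real.rpow_mul (by positivity), one_div_mul_eq_div, ← hα]
      rcases Nat.eq_zero_or_pos B.card with h0 | h0
      · have := one_le_alphaExp hp.out hq.out
        simp [h0, Real.zero_rpow (by linarith : alphaExp p q ≠ 0)]
      · have h1 : (0 : ℝ) < B.card := by exact_mod_cast h0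
        calc (B.card : ℝ) ^ alphaExp p q = B.card * (B.card : ℝ) ^ (alphaExp p q - 1) := by
              rw [mul_comm, ← Real.rpow_add_one h1.ne', sub_add_cancel]
          _ ≤ _ := by
              have := one_le_alphaExp hp.out hq.out
              have : (B.card : ℝ) ≤ N := by exact_mod_cast hB
              gcongr
  · obtain ⟨e, rfl⟩ : ∃ e, d = e + 1 := ⟨d - 1, by omega⟩
    set m := Real.conjExponent p / Real.conjExponent q with hm
    have hm1 : 1 < m := by
      rw [hm, one_lt_div hq'0, Real.conjExponent, Real.conjExponent,
        div_lt_div_iff₀ hqq.sub_one_pos hpp.sub_one_pos]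
      linarith
    obtain ⟨C, hC, hle⟩ := DyadicRect.lintegral_sum_normInd_rpow_le e hm1
    refine ⟨C, hC, fun 𝕜 _ x N B hN hB => ?_⟩
    have hlog : 0 ≤ Real.log N := Real.log_natCast_nonneg N
    have hX : 0 ≤ C * B.card * (1 + Real.log N) ^ (e * (m - 1)) := by positivity
    refine ⟨_, by positivity, sum_norm_coord_le x B hX (hle N B hN hB), le_of_eq ?_⟩
    have hα : alphaExp p q = 1 := if_pos h.le
    have hh : Real.conjExponent p * hExp p q (e + 1) = e * (m - 1) := by
      have h1 : 0 ≤ 1 / p - 1 / q := sub_nonneg.mpr (one_div_le_one_div_of_le hp0 h.le)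
      have h2 : m - 1 = Real.conjExponent p * (1 / p - 1 / q) := by
        have e1 := hpp.inv_add_inv_eq_one
        have e2 := hqq.inv_add_inv_eq_one
        rw [hm, one_div, one_div, show p⁻¹ - q⁻¹ =
          (Real.conjExponent q)⁻¹ - (Real.conjExponent p)⁻¹ by linarith, mul_sub,
          mul_inv_cancel₀ hp'0.ne', div_eq_mul_inv]
      rw [hExp, max_eq_left h1, h2]
      push_cast
      ring
    rw [min_eq_left h.le, growth, hα, hh, sub_self, Real.rpow_zero, mul_one,
      ← Real.rpow_mul hX, one_div_mul_cancel hp'0.ne', Real.rpow_one]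

/-- If a set `B` of coordinates carries half of the norm of `x`, a coordinate chosen greedily with
parameter `τ` decreases the norm by a definite amount. -/
theorem norm_restr_compl_rpow_le_of_greedy (p q : ℝ) [hp : Fact (1 < p)] [hq : Fact (1 < q)]
    {d : ℕ} (hd : 1 ≤ d) {τ : ℝ} (hτ : 0 < τ) :
    ∃ Θ : ℝ, 1 ≤ Θ ∧ ∀ (𝕜 : Type) [RCLike 𝕜] (x : Fpq 𝕜 d p q)
      (F : StrongDual 𝕜 (Fpq 𝕜 d p q)), IsNorming F x → ∀ I : DyadicRect d,
      (∀ J, τ * ‖F (basis 𝕜 d p q J)‖ ≤ ‖F (basis 𝕜 d p q I)‖) →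
      ∀ (N : ℕ) (B : Finset (DyadicRect d)), 1 ≤ N → B.card ≤ N →
      2 * ‖restr x (B : Set (DyadicRect d))ᶜ‖ < ‖x‖ →
      ‖restr x {I}ᶜ‖ ^ p ≤ (1 - (Θ * growth p q d N * B.card)⁻¹) * ‖x‖ ^ p := by
  classical
  have hp0 : 0 < p := one_pos.trans hp.out
  obtain ⟨κ, hκ, hdecay⟩ := norm_restr_compl_rpow_le p q
  obtain ⟨C, hC, hdual⟩ := sum_norm_coord_le_growth p q hd
  set s' := Real.conjExponent (min p q) with hs'
  have hs'0 : 0 < s' := (Real.HolderConjugate.conjExponent (lt_min hp.out hq.out)).symm.pos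
  set Θ₀ : ℝ := C * (2 / τ) ^ s' / κ with hΘ₀
  have hΘ₀pos : 0 < Θ₀ := by positivity
  refine ⟨max 1 Θ₀, le_max_left _ _, fun 𝕜 _ x F hF I hI N B hN hB hhalf => ?_⟩
  have hx : 0 < ‖x‖ := lt_of_le_of_lt (by positivity) hhalf
  obtain ⟨K, hK0, hK, hKpow⟩ := hdual 𝕜 x N B hN hB
  refine (hdecay 𝕜 d x F hF I).trans (mul_le_mul_of_nonneg_right ?_ (by positivity))
  set Φ := ‖F (basis 𝕜 d p q I)‖ with hΦ
  have hsplit : x = restr x B + restr x (B : Set (DyadicRect d))ᶜ := by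
    ext J
    rw [coord_add]
    by_cases hJ : J ∈ B <;> simp [coord_restr, hJ]
  have h1 : ‖x‖ ≤ ‖F (restr x B)‖ + ‖restr x (B : Set (DyadicRect d))ᶜ‖ := by
    have e1 : ‖F x‖ = ‖x‖ := by rw [hF.2, RCLike.norm_ofReal, abs_of_pos hx]
    have e2 := F.le_opNorm (restr x (B : Set (DyadicRect d))ᶜ)
    rw [hF.1, one_mul] at e2
    rw [← e1]
    conv_lhs => rw [hsplit, map_add]
    exact (norm_add_le _ _).trans (add_le_add_right e2 _)
  clear hsplit
  have h2 : τ * ‖F (restr x B)‖ ≤ K * ‖x‖ * Φ := by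
    rw [restr_finset_eq_sum, map_sum]
    calc τ * ‖∑ J ∈ B, F (x.coord J • basis 𝕜 d p q J)‖
        ≤ τ * ∑ J ∈ B, ‖x.coord J‖ * ‖F (basis 𝕜 d p q J)‖ := by
          refine mul_le_mul_of_nonneg_left ((norm_sum_le _ _).trans (le_of_eq ?_)) hτ.le
          exact Finset.sum_congr rfl fun J _ => by rw [map_smul, norm_smul]
      _ = ∑ J ∈ B, ‖x.coord J‖ * (τ * ‖F (basis 𝕜 d p q J)‖) := by
          rw [Finset.mul_sum]; exact Finset.sum_congr rfl fun J _ => by ring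
      _ ≤ ∑ J ∈ B, ‖x.coord J‖ * Φ :=
          Finset.sum_le_sum fun J _ => mul_le_mul_of_nonneg_left (hI J) (norm_nonneg _)
      _ ≤ _ := by rw [← Finset.sum_mul]; exact mul_le_mul_of_nonneg_right hK (norm_nonneg _)
  -- `F` must see at least half of `‖x‖` on `B`, and there its values are at most `Φ / τ` by the
  -- greedy choice.
  have h3 : τ / 2 ≤ K * Φ := by
    have h4 : τ * (‖x‖ / 2) ≤ K * Φ * ‖x‖ := by
      calc τ * (‖x‖ / 2) ≤ τ * ‖F (restr x B)‖ := by
            refine mul_le_mul_of_nonneg_left ?_ hτ.le; linarith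
        _ ≤ _ := h2.trans (le_of_eq (by ring))
    have : τ / 2 * ‖x‖ ≤ K * Φ * ‖x‖ := by linarith
    exact le_of_mul_le_mul_right this hx
  have hg : 1 ≤ growth p q d N := one_le_growth hp.out hq.out hd hN
  have hΦ0 : 0 ≤ Φ := norm_nonneg _
  have h5 : (τ / 2) ^ s' ≤ C * B.card * growth p q d N * Φ ^ s' := by
    refine (Real.rpow_le_rpow (by positivity) h3 hs'0.le).trans ?_
    rw [Real.mul_rpow hK0 hΦ0]
    gcongr
  have hprod : 0 < C * B.card * growth p q d N * Φ ^ s' := lt_of_lt_of_le (by positivity) h5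
  have hBpos : (0 : ℝ) < B.card := by
    rcases (Nat.cast_nonneg (α := ℝ) B.card).eq_or_lt with h0 | h0
    · rw [← h0] at hprod; simp at hprod
    · exact h0
  have h6 : (max 1 Θ₀ * growth p q d N * B.card)⁻¹ ≤ κ * Φ ^ s' := by
    have h7 : (Θ₀ * growth p q d N * B.card)⁻¹ ≤ κ * Φ ^ s' := by
      rw [inv_le_iff_one_le_mul₀ (by positivity)]
      have e1 : κ * Φ ^ s' * (Θ₀ * growth p q d N * B.card) =
          (2 / τ) ^ s' * (C * B.card * growth p q d N * Φ ^ s') := by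
        rw [hΘ₀]; field_simp
      rw [e1]
      calc (1 : ℝ) = (2 / τ) ^ s' * (τ / 2) ^ s' := by
            rw [← Real.mul_rpow (by positivity) (by positivity)]
            rw [show 2 / τ * (τ / 2) = 1 by field_simp, Real.one_rpow]
        _ ≤ _ := by gcongr
    refine le_trans (inv_anti₀ (by positivity) ?_) h7
    gcongr
    exact le_max_right _ _
  linarith

/-! ### Runs of the algorithm -/

section Run

variable {𝕜 : Type} [RCLike 𝕜] {d : ℕ} {p q : ℝ} [hp : Fact (1 < p)] [hq : Fact (1 < q)]

lemma coord_eq_zero_of_mem_span {S : Set (DyadicRect d)} {y : Fpq 𝕜 d p q}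
    (hy : y ∈ Submodule.span 𝕜 (basis 𝕜 d p q '' S)) {J : DyadicRect d} (hJ : J ∉ S) :
    y.coord J = 0 := by
  classical
  induction hy using Submodule.span_induction with
  | mem z hz =>
    obtain ⟨I, hI, rfl⟩ := hz
    rw [coord_basis, if_neg]
    rintro rfl
    exact hJ hI
  | zero => rfl
  | add a b _ _ ha hb => rw [coord_add, ha, hb, add_zero]
  | smul c a _ ha => rw [coord_smul, ha, mul_zero]

/-- The best approximation from a coordinate subspace is the coordinate projection. -/
lemma sub_eq_restr_of_best {S : Set (DyadicRect d)} (hS : S.Finite) {x g : Fpq 𝕜 d p q}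
    (hg : g ∈ Submodule.span 𝕜 (basis 𝕜 d p q '' S))
    (hbest : ‖x - g‖ =
      Metric.infDist x (Submodule.span 𝕜 (basis 𝕜 d p q '' S) : Set (Fpq 𝕜 d p q))) :
    x - g = restr x Sᶜ := by
  have hoff : ∀ J ∉ S, (x - g).coord J = x.coord J := fun J hJ => by
    rw [coord_sub, coord_eq_zero_of_mem_span hg hJ, sub_zero]
  have hin : restr x S ∈ Submodule.span 𝕜 (basis 𝕜 d p q '' S) := by
    rw [← hS.coe_toFinset, restr_finset_eq_sum]
    refine Submodule.sum_mem _ fun I hI => Submodule.smul_mem _ _ (Submodule.subset_span ?_)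
    exact ⟨I, hI, rfl⟩
  have hsub : x - restr x S = restr x Sᶜ := by
    ext J
    by_cases hJ : J ∈ S <;> simp [coord_restr, hJ]
  -- The coordinate projection competes with `g`, and both agree with `x` off `S`. Deleting a
  -- coordinate `J ∈ S` of `x - g` thus cannot lower its norm, and strict monotonicity makes that
  -- coordinate zero.
  have hle : ‖x - g‖ ≤ ‖restr x Sᶜ‖ := by
    rw [hbest, ← hsub, ← dist_eq_norm]
    exact Metric.infDist_le_dist_of_mem hin
  ext J
  by_cases hJ : J ∈ S
  · rw [coord_restr_of_notMem x (by simpa using hJ)]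
    refine coord_eq_zero_of_norm_le (hle.trans (norm_mono fun I => ?_))
    by_cases hI : I ∈ S
    · rw [coord_restr_of_notMem x (by simpa using hI), norm_zero]
      exact norm_nonneg _
    · have hIJ : I ∈ ({J} : Set (DyadicRect d))ᶜ := by
        rintro rfl
        exact hI hJ
      rw [coord_restr_of_mem x hI, coord_restr_of_mem _ hIJ, hoff I hI]
  · rw [coord_restr_of_mem x hJ, hoff J hJ]

variable {τ : ℝ} {x : Fpq 𝕜 d p q} {i : ℕ → DyadicRect d} {G : ℕ → Fpq 𝕜 d p q}

lemma _root_.Greedy.IsWCGA.sub_succ_eq (h : IsWCGA 𝕜 (basis 𝕜 d p q) τ x i G) {n : ℕ} (hn : x - G n ≠ 0) :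
    x - G (n + 1) = restr x (i '' Set.Iic n)ᶜ := by
  have hset : (fun m => basis 𝕜 d p q (i m)) '' Set.Iic n =
      basis 𝕜 d p q '' (i '' Set.Iic n) := by rw [Set.image_image]
  refine sub_eq_restr_of_best ((Set.finite_Iic n).image i) ?_ ?_
  · rw [← hset]; exact h.mem_span n hn
  · rw [← hset]; exact h.best n hn

lemma _root_.Greedy.IsWCGA.sub_eq (h : IsWCGA 𝕜 (basis 𝕜 d p q) τ x i G) {n : ℕ} (hn : x - G n ≠ 0) :
    x - G n = restr x (i '' Set.Iio n)ᶜ := by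
  cases n with
  | zero => rw [h.zero, sub_zero]; ext J; simp [coord_restr]
  | succ n =>
    have hn' : x - G n ≠ 0 := fun h0 => hn (by rw [h.halt n h0, h0])
    have hset : Set.Iio (n + 1) = Set.Iic n := by ext m; simp
    rw [h.sub_succ_eq hn', hset]

/-- The coordinates that survive after `n` steps. -/
def remaining (x : Fpq 𝕜 d p q) (G : ℕ → Fpq 𝕜 d p q) (n : ℕ) : Set (DyadicRect d) :=
  {I | (x - G n).coord I ≠ 0}

/-- Using the support of the remainder instead of the unselected indices also covers a halted run,
whose later indices are unconstrained. -/
lemma _root_.Greedy.IsWCGA.sub_eq_restr_remaining (h : IsWCGA 𝕜 (basis 𝕜 d p q) τ x i G) (n : ℕ) :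
    x - G n = restr x (remaining x G n) := by
  ext J
  by_cases hJ : J ∈ remaining x G n
  · rw [coord_restr_of_mem x hJ]
    have hn : x - G n ≠ 0 := by
      intro h0
      apply hJ
      rw [h0, coord_zero]
    have hJ' : (x - G n).coord J ≠ 0 := hJ
    rw [h.sub_eq hn] at hJ' ⊢
    by_cases hm : J ∈ (i '' Set.Iio n)ᶜ
    · exact coord_restr_of_mem x hm
    · exact absurd (coord_restr_of_notMem x hm) hJ'
  · rw [coord_restr_of_notMem x hJ]
    exact not_not.mp hJ

lemma _root_.Greedy.IsWCGA.antitone_remaining (h : IsWCGA 𝕜 (basis 𝕜 d p q) τ x i G) :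
    Antitone (remaining x G) := by
  refine antitone_nat_of_succ_le fun n J hJ => ?_
  have hJ' : (x - G (n + 1)).coord J ≠ 0 := hJ
  change (x - G n).coord J ≠ 0
  by_cases hn : x - G n = 0
  · rwa [h.halt n hn] at hJ'
  · rw [h.sub_succ_eq hn] at hJ'
    rw [h.sub_eq hn]
    by_cases hm : J ∈ (i '' Set.Iic n)ᶜ
    · rw [coord_restr_of_mem x hm] at hJ'
      rwa [coord_restr_of_mem x]
      exact fun h' => hm (Set.image_mono Set.Iio_subset_Iic_self h')
    · exact absurd (coord_restr_of_notMem x hm) hJ'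

lemma _root_.Greedy.IsWCGA.norm_sub_succ_le (h : IsWCGA 𝕜 (basis 𝕜 d p q) τ x i G) {n : ℕ}
    (hn : x - G n ≠ 0) : ‖x - G (n + 1)‖ ≤ ‖restr (x - G n) {i n}ᶜ‖ := by
  rw [h.sub_succ_eq hn, h.sub_eq hn]
  refine norm_mono fun J => ?_
  by_cases hm : J ∈ (i '' Set.Iic n)ᶜ
  · have h1 : J ∈ ({i n} : Set (DyadicRect d))ᶜ := by
      rintro rfl
      exact hm ⟨n, Set.mem_Iic.mpr le_rfl, rfl⟩
    have h2 : J ∈ (i '' Set.Iio n)ᶜ :=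
      fun h' => hm (Set.image_mono Set.Iio_subset_Iic_self h')
    rw [coord_restr_of_mem x hm, coord_restr_of_mem _ h1, coord_restr_of_mem x h2]
  · rw [coord_restr_of_notMem x hm, norm_zero]
    exact norm_nonneg _

lemma restr_restr (x : Fpq 𝕜 d p q) (S T : Set (DyadicRect d)) :
    restr (restr x S) T = restr x (S ∩ T) := by
  ext J
  by_cases h1 : J ∈ S <;> by_cases h2 : J ∈ T <;> simp [coord_restr, h1, h2]

/-- Almost best `N`-term approximations are given by coordinate projections. -/
lemma exists_norm_restr_compl_lt (x : Fpq 𝕜 d p q) (N : ℕ) {ε : ℝ} (hε : 0 < ε) :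
    ∃ A : Finset (DyadicRect d), A.card ≤ N ∧
      ‖restr x (A : Set (DyadicRect d))ᶜ‖ < sigma 𝕜 (basis 𝕜 d p q) N x + ε := by
  have hne : (sparse 𝕜 (basis 𝕜 d p q) N).Nonempty := ⟨0, ∅, 0, by simp, by simp⟩
  have h1 : Metric.infDist x (sparse 𝕜 (basis 𝕜 d p q) N) <
      sigma 𝕜 (basis 𝕜 d p q) N x + ε := by
    unfold sigma; linarith
  obtain ⟨y, ⟨A, a, hA, rfl⟩, hy⟩ := (Metric.infDist_lt_iff hne).mp h1
  refine ⟨A, hA, lt_of_le_of_lt (norm_mono fun J => ?_) (dist_eq_norm x _ ▸ hy)⟩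
  by_cases hJ : J ∈ A
  · rw [coord_restr_of_notMem x (by simpa using hJ), norm_zero]
    exact norm_nonneg _
  · have hspan : ∑ I ∈ A, a I • basis 𝕜 d p q I ∈
        Submodule.span 𝕜 (basis 𝕜 d p q '' (A : Set (DyadicRect d))) :=
      Submodule.sum_mem _ fun I hI =>
        Submodule.smul_mem _ _ (Submodule.subset_span ⟨I, hI, rfl⟩)
    rw [coord_restr_of_mem x (by simpa using hJ), coord_sub,
      coord_eq_zero_of_mem_span hspan (by simpa using hJ), sub_zero]

end Run

end Fpq

open Fpq in
/-- The Lebesgue-type inequality for the WCGA in `f_{p,q}`, with constant `2`. -/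
theorem norm_sub_le_sigma (p q : ℝ) [hp : Fact (1 < p)] [hq : Fact (1 < q)] {d : ℕ} (hd : 1 ≤ d)
    {τ : ℝ} (hτ : 0 < τ) : ∃ c : ℝ, 0 < c ∧
      ∀ (𝕜 : Type) [RCLike 𝕜] (x : Fpq 𝕜 d p q) (i : ℕ → DyadicRect d) (G : ℕ → Fpq 𝕜 d p q),
        IsWCGA 𝕜 (Fpq.basis 𝕜 d p q) τ x i G → ∀ N : ℕ, 1 ≤ N →
          ‖x - G (phiFun p q d c N)‖ ≤ 2 * sigma 𝕜 (Fpq.basis 𝕜 d p q) N x := by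
  classical
  have hp0 : 0 < p := one_pos.trans hp.out
  obtain ⟨Θ, hΘ, hgreedy⟩ := norm_restr_compl_rpow_le_of_greedy p q hd hτ
  have hlog4 : 0 < Real.log 4 := Real.log_pos (by norm_num)
  -- The `4` is the factor lost in `greedy_steps_le`; the `+ 1` pays for the ceiling in `T`, as
  -- `growth` is at least `1`.
  refine ⟨4 * (p * Real.log 4 * Θ + 1), by positivity, fun 𝕜 _ x i G hrun N hN => ?_⟩
  set g := growth p q d N with hg
  have hg1 : 1 ≤ g := one_le_growth hp.out hq.out hd hN
  set T : ℕ := ⌈p * Real.log 4 * (Θ * g)⌉₊ with hT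
  have hφ : 4 * T * N ≤ phiFun p q d (4 * (p * Real.log 4 * Θ + 1)) N := by
    refine Nat.le_floor ?_
    have hN0 : (0 : ℝ) < N := by exact_mod_cast hN
    have h1 : (T : ℝ) ≤ (p * Real.log 4 * Θ + 1) * g := by
      have := (Nat.ceil_lt_add_one (show 0 ≤ p * Real.log 4 * (Θ * g) by positivity)).le
      rw [← hT] at this
      linarith
    have h2 : 4 * (p * Real.log 4 * Θ + 1) *
        (1 + Real.log N) ^ (Real.conjExponent p * hExp p q d) * (N : ℝ) ^ alphaExp p q =
        4 * ((p * Real.log 4 * Θ + 1) * g) * N := by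
      have : (N : ℝ) ^ alphaExp p q = (N : ℝ) ^ (alphaExp p q - 1) * N := by
        rw [← Real.rpow_add_one hN0.ne', sub_add_cancel]
      rw [this, hg, growth]
      ring
    rw [h2]
    push_cast
    gcongr
  have hrem := hrun.sub_eq_restr_remaining
  have hanti := hrun.antitone_remaining
  set S := remaining x G with hS
  set ν : Set (DyadicRect d) → ℝ := fun s => ‖restr x s‖ with hν
  have hmono : Monotone ν := norm_restr_mono x
  have hnonneg : ∀ s, 0 ≤ ν s := fun s => norm_nonneg _
  -- The infimum defining `sigma` is approached only up to `ε / 2`, which the constant `2` turns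
  -- into `ε`.
  refine le_of_forall_pos_le_add fun ε hε => ?_
  obtain ⟨A, hAN, hA⟩ := exists_norm_restr_compl_lt x N (half_pos hε)
  have hsteps := greedy_steps_le hmono (norm_restr_union_le x) hnonneg hanti A T ?_
  · calc ‖x - G (phiFun p q d (4 * (p * Real.log 4 * Θ + 1)) N)‖
        = ν (S (phiFun p q d (4 * (p * Real.log 4 * Θ + 1)) N)) := by rw [hrem]
      _ ≤ ν (S (4 * T * A.card)) :=
        hmono (hanti ((Nat.mul_le_mul_left _ hAN).trans hφ))
      _ ≤ 2 * ν (Aᶜ : Set (DyadicRect d)) := hsteps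
      _ ≤ _ := by simp only [hν]; linarith
  · intro n B M hBA hBM
    have hBN : B.card ≤ N := (Finset.card_le_card hBA).trans hAN
    -- The empty set is treated apart because the decay rate contains the inverse of `|B|`.
    rcases Nat.eq_zero_or_pos B.card with hB0 | hB0
    · rw [Finset.card_eq_zero] at hB0
      subst hB0
      refine le_max_of_le_left ?_
      have h1 : ν (S (n + T * M)) ≤ ν (S n) := hmono (hanti (Nat.le_add_right _ _))
      have h2 := hnonneg (S n)
      simp only [Finset.coe_empty, Set.sdiff_empty]
      linarith
    have hB1 : (1 : ℝ) ≤ B.card := by exact_mod_cast hB0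
    have hpos : 1 ≤ Θ * g * B.card :=
      one_le_mul_of_one_le_of_one_le (one_le_mul_of_one_le_of_one_le hΘ hg1) hB1
    refine le_max_of_decay hmono hnonneg hanti hp0 (δ := (Θ * g * B.card)⁻¹)
      (inv_le_one_of_one_le₀ hpos) ?_ ?_ n
    · intro n hlt
      have hne : x - G n ≠ 0 := by
        intro h0
        have h1 : ν (S n) = 0 := by simp only [hν]; rw [← hrem, h0, norm_zero]
        rw [h1] at hlt
        linarith [hnonneg (S n \ B)]
      obtain ⟨F, hF, hsel⟩ := hrun.select n hne
      have hkey := hgreedy 𝕜 (x - G n) F hF (i n) hsel N B hN hBN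
        (by rw [hrem, restr_restr]; exact hlt)
      have h1 := hrun.norm_sub_succ_le hne
      have h2 : ν (S (n + 1)) = ‖x - G (n + 1)‖ := by rw [hrem]
      have h3 : ν (S n) = ‖x - G n‖ := by rw [hrem]
      rw [h2, h3]
      exact (Real.rpow_le_rpow (norm_nonneg _) h1 hp0.le).trans hkey
    -- The rate is inversely proportional to `|B|` with a factor depending only on `N`, so `T * M`
    -- steps suffice with one `T` for all `B ⊆ A`.
    · rw [inv_mul_eq_div, le_div_iff₀ (by positivity)]
      have h1 : p * Real.log 4 * (Θ * g) ≤ T := Nat.le_ceil _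
      have h2 : (B.card : ℝ) ≤ M := by exact_mod_cast hBM
      push_cast
      calc p * Real.log 4 * (Θ * g * B.card) = p * Real.log 4 * (Θ * g) * B.card := by ring
        _ ≤ T * M := by gcongr

end Greedy

end

theorem mainTheorem4 :
    ∃ C : ℝ, 1 ≤ C ∧
      ∀ (d : ℕ) (p q τ : ℝ) [Fact (1 < p)] [Fact (1 < q)], 1 ≤ d → 0 < τ → τ ≤ 1 →
        ∃ c : ℝ, 0 < c ∧
          ∀ (𝕜 : Type) [RCLike 𝕜] (x : Greedy.Fpq 𝕜 d p q)
            (i : ℕ → Greedy.DyadicRect d) (G : ℕ → Greedy.Fpq 𝕜 d p q),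
            Greedy.IsWCGA 𝕜 (Greedy.Fpq.basis 𝕜 d p q) τ x i G →
            ∀ N : ℕ, 1 ≤ N →
              ‖x - G (Greedy.phiFun p q d c N)‖ ≤
                C * Greedy.sigma 𝕜 (Greedy.Fpq.basis 𝕜 d p q) N x := by
  refine ⟨2, by norm_num, fun d p q τ _ _ hd hτ _ => ?_⟩
  obtain ⟨c, hc, h⟩ := Greedy.norm_sub_le_sigma p q hd hτ
  exact ⟨c, hc, fun 𝕜 _ x i G hrun N hN => h 𝕜 x i G hrun N hN⟩
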